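/- Let $d,m,s\ge 1$. Let $\Omega\subset\mathbb R^d$ be a (full-rank) lattice with dual lattice $\Gamma=\{\gamma:\langle\gamma,\omega\rangle\in2\pi\mathbb Z\ \forall\omega\in\Omega\}$, let $F$ be a bounded fundamental domain of $\Omega$, and let $F^\star\subset\mathbb R^d$ be a fundamental domain of $\Gamma$, that is, a set containing exactly one point of each class of $\mathbb R^d$ modulo $\Gamma$. Write $D_\alpha=(\frac1i\partial_{x_1})^{\alpha_1}\cdots(\frac1i\partial_{x_d})^{\alpha_d}$. For $|\alpha|=2s$ let $Q_\alpha$ be a constant real $m\times m$ matrix; for $|\alpha|\le 2s-1$ let $Q_\alpha(x)$ be an $m\times m$ matrix of bounded measurable $\Omega$-periodic functions. For $t\in F^\star$ let $B_t$ be a bounded operator in $L_2^m(F)$, depending continuously on $t\in F^\star$ in the operator norm (for instance one fixed operator $B$). For $t\in F^\star$ let $T_t$ be the operator in $L_2^m(F)$ given by $$T_tu=\sum_{|\alpha|=2s}Q_\alpha D_\alpha u+\sum_{|\alpha|\le 2s-1}Q_\alpha(x)D_\alpha u+B_tu ,$$ whose domain $D(T_t)$ consists of those $u\in L_2^m(F)$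 whose extension to $\mathbb R^d$ by $u(x+\omega)=e^{i\langle t,\omega\rangle}u(x)$, $\omega\in\Omega$, has weak derivatives $D_\alpha u$ on $\mathbb R^d$, square integrable on $F$, for all $|\alpha|\le 2s$. Assume that (i) for every $t\in F^\star$ the operator $T_t$ is self-adjoint, bounded below, and has compact resolvent; (ii) there are $\delta>0$ and $c>0$ such that $\|T_tu+cu-B_tu\|+\|u\|\ge\delta\sum_{|\alpha|\le 2s-1}\|D_\alpha u\|$ for all $t\in F^\star$ and $u\in D(T_t)$, with the norms of $L_2^m(F)$. Let $\lambda_1(t)\le\lambda_2(t)\le\cdots$ be the eigenvalues of $T_t$ counted with multiplicity, let $n\ge1$ and $a\in F^\star$, and suppose that $\lambda_n(a)$ is a simple eigenvalue of $T_a$. Fix $v\in\mathbb C^m$ (for $m=1$ one takes $v=1$), let $(\cdot,\cdot)$ be the inner product of $L_2^m(F)$, and suppose that there are $\varepsilon>0$ and a neighbourhood of $a$ in $F^\star$ such that $|(\Psi,e^{i\langle t,x\rangle}v)|>\varepsilon$ for all $t$ in it and every normalized eigenfunction $\Psi$ of $T_t$ for the eigenvalue $\lambda_n(t)$. Then there is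 a neighbourhood $U\subset F^\star$ of $a$ in $F^\star$ such that for each $t\in U$ the eigenvalue $\lambda_n(t)$ of $T_t$ is simple, there is exactly one normalized eigenfunction $\Psi_{n,t}$ of $T_t$ for $\lambda_n(t)$ with $\arg(\Psi_{n,t},e^{i\langle t,x\rangle}v)=0$, and the map $t\mapsto\Psi_{n,t}\in L_2^m(F)$ is continuous on $U$. -/

import Mathlib

open MeasureTheory Filter Topology

noncomputable section

namespace Bloch

/-- The space `ℝᵈ` with its Euclidean structure. -/
abbrev Space (d : ℕ) : Type := EuclideanSpace ℝ (Fin d)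

/-- The values `ℂᵐ` of the vector functions, with the Euclidean structure. -/
abbrev Vec (m : ℕ) : Type := EuclideanSpace ℂ (Fin m)

/-- The Hilbert space `L₂ᵐ(F)`. -/
abbrev L2 {d : ℕ} (m : ℕ) (F : Set (Space d)) : Type :=
  Lp (Vec m) 2 ((volume : Measure (Space d)).restrict F)

/-! ### Lattices -/

/-- The lattice dual to `Ω`: all `γ` with `⟨γ, ω⟩ ∈ 2πℤ` for every `ω ∈ Ω`. -/
def dualLattice {d : ℕ} (Ω : Submodule ℤ (Space d)) : Set (Space d) :=
  {γ | ∀ ω ∈ Ω, ∃ k : ℤ, inner ℝ γ ω = 2 * Real.pi * k}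

/-- `S` contains exactly one point of each class of `ℝᵈ` modulo the translations in `Γ`. -/
def IsFundamentalSet {d : ℕ} (Γ S : Set (Space d)) : Prop :=
  (∀ x : Space d, ∃ γ ∈ Γ, ∃ t ∈ S, γ + t = x) ∧
    ∀ t ∈ S, ∀ γ ∈ Γ, γ ≠ 0 → γ + t ∉ S

/-- The character value `e^{i⟨t, x⟩}`. -/
def expi {d : ℕ} (t x : Space d) : ℂ := Complex.exp (Complex.I * ((inner ℝ t x : ℝ) : ℂ))

/-! ### Weak derivatives -/

/-- `D_k = (1/i) ∂/∂x_k` on differentiable scalar functions. -/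
def partialD {d : ℕ} (k : Fin d) (φ : Space d → ℂ) : Space d → ℂ :=
  fun x => (1 / Complex.I) * fderiv ℝ φ x (EuclideanSpace.single k 1)

/-- `D_α = D_1^{α_1} ⋯ D_d^{α_d}` on smooth scalar functions. -/
def mixedD {d : ℕ} (α : Fin d → ℕ) (φ : Space d → ℂ) : Space d → ℂ :=
  (List.finRange d).foldr (fun k ψ => (partialD k)^[α k] ψ) φ

/-- `w = D_α u` in the weak sense on `ℝᵈ`, for locally integrable `u` and `w`. -/
structure HasWeakD {d m : ℕ} (α : Fin d → ℕ) (u w : Space d → Vec m) : Prop where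
  locallyIntegrable_left : LocallyIntegrable u volume
  locallyIntegrable_right : LocallyIntegrable w volume
  integral_eq : ∀ φ : Space d → ℂ, ContDiff ℝ (⊤ : ℕ∞) φ → HasCompactSupport φ →
    ∫ x, φ x • w x = (-1 : ℂ) ^ (∑ i, α i) • ∫ x, mixedD α φ x • u x

/-- `u` satisfies `u(x + ω) = e^{i⟨t, ω⟩} u(x)` for all `ω ∈ Ω` (and almost all `x`). -/
def IsQuasiperiodic {d m : ℕ} (Ω : Submodule ℤ (Space d)) (t : Space d)
    (u : Space d → Vec m) : Prop :=
  ∀ ω ∈ Ω, ∀ᵐ x, u (x + ω) = expi t ω • u x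

/-- `u` is the `t`-quasiperiodic extension to `ℝᵈ` of `f ∈ L₂ᵐ(F)`, and it has the weak derivatives
`w α = D_α u`, square integrable over `F`, for all `|α| ≤ N`. -/
structure IsJet {d m : ℕ} (Ω : Submodule ℤ (Space d)) (F : Set (Space d)) (N : ℕ) (t : Space d)
    (f : L2 m F) (u : Space d → Vec m) (w : (Fin d → ℕ) → Space d → Vec m) : Prop where
  extends_f : f =ᵐ[volume.restrict F] u
  quasiperiodic : IsQuasiperiodic Ω t u
  memLp : ∀ α : Fin d → ℕ, ∑ i, α i ≤ N → MemLp (w α) 2 (volume.restrict F)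
  hasWeakD : ∀ α : Fin d → ℕ, ∑ i, α i ≤ N → HasWeakD α u (w α)

/-! ### The differential expression -/

/-- The multi-indices `α` with `|α| = N`. -/
def multiIndices (d N : ℕ) : Finset (Fin d → ℕ) := Finset.univ.piAntidiag N

/-- The multi-indices `α` with `|α| < N`. -/
def multiIndicesLT (d N : ℕ) : Finset (Fin d → ℕ) := (Finset.range N).biUnion (multiIndices d)

theorem mem_multiIndices {d N : ℕ} {α : Fin d → ℕ} : α ∈ multiIndices d N ↔ ∑ i, α i = N := by
  simp [multiIndices]

theorem mem_multiIndicesLT {d N : ℕ} {α : Fin d → ℕ} :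
    α ∈ multiIndicesLT d N ↔ ∑ i, α i < N := by
  simp [multiIndicesLT, mem_multiIndices]

/-- The coefficients of a differential expression
`∑_{|α| = 2s} Q_α D_α u + ∑_{|α| ≤ 2s - 1} Q_α(x) D_α u` of order `2s` in `ℝᵈ` on `ℂᵐ`-valued
functions: constant real matrices in the principal part, bounded measurable `Ω`-periodic matrix
functions in the lower-order part. -/
structure DiffExpr (d m : ℕ) (Ω : Submodule ℤ (Space d)) where
  /-- The matrices `Q_α`, `|α| = 2s`. -/
  top : (Fin d → ℕ) → Matrix (Fin m) (Fin m) ℝ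
  /-- The matrix functions `Q_α(x)`, `|α| ≤ 2s - 1`. -/
  low : (Fin d → ℕ) → Space d → Matrix (Fin m) (Fin m) ℂ
  low_measurable : ∀ α i j, Measurable fun x => low α x i j
  low_bounded : ∀ α, ∃ C : ℝ, ∀ x i j, ‖low α x i j‖ ≤ C
  low_periodic : ∀ α, ∀ ω ∈ Ω, ∀ x, low α (x + ω) = low α x

/-- The value of the expression of order `2s` on a function with derivatives `w α = D_α u`. -/
def DiffExpr.apply {d m : ℕ} {Ω : Submodule ℤ (Space d)} (Q : DiffExpr d m Ω) (s : ℕ)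
    (w : (Fin d → ℕ) → Space d → Vec m) (x : Space d) : Vec m :=
  (∑ α ∈ multiIndices d (2 * s), ((Q.top α).map Complex.ofReal).toEuclideanLin (w α x)) +
    ∑ α ∈ multiIndicesLT d (2 * s), (Q.low α x).toEuclideanLin (w α x)

theorem partialD_iterate_smooth {d : ℕ} (k : Fin d) (n : ℕ) (φ : Space d → ℂ)
    (h : ContDiff ℝ (⊤ : ℕ∞) φ) (hc : HasCompactSupport φ) :
    ContDiff ℝ (⊤ : ℕ∞) ((partialD k)^[n] φ) ∧ HasCompactSupport ((partialD k)^[n] φ) := by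
  induction n generalizing φ with
  | zero => exact ⟨h, hc⟩
  | succ n ih =>
    rw [Function.iterate_succ_apply]
    refine ih _ ?_ ?_
    · exact contDiff_const.mul ((h.fderiv_right (m := (⊤ : ℕ∞)) (by simp)).clm_apply contDiff_const)
    · exact (hc.fderiv_apply (𝕜 := ℝ) (EuclideanSpace.single k 1)).mul_left

theorem mixedD_smooth {d : ℕ} (α : Fin d → ℕ) (φ : Space d → ℂ)
    (h : ContDiff ℝ (⊤ : ℕ∞) φ) (hc : HasCompactSupport φ) :
    ContDiff ℝ (⊤ : ℕ∞) (mixedD α φ) ∧ HasCompactSupport (mixedD α φ) := by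
  unfold mixedD
  induction List.finRange d with
  | nil => exact ⟨h, hc⟩
  | cons k l ih => exact partialD_iterate_smooth k _ _ ih.1 ih.2

theorem HasWeakD.add {d m : ℕ} {α : Fin d → ℕ} {u₁ u₂ w₁ w₂ : Space d → Vec m}
    (h₁ : HasWeakD α u₁ w₁) (h₂ : HasWeakD α u₂ w₂) :
    HasWeakD α (u₁ + u₂) (w₁ + w₂) where
  locallyIntegrable_left := h₁.1.add h₂.1
  locallyIntegrable_right := h₁.2.add h₂.2
  integral_eq φ hφ hc := by
    obtain ⟨hD, hDc⟩ := mixedD_smooth α φ hφ hc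
    simp only [Pi.add_apply, smul_add]
    rw [integral_add (h₁.2.integrable_smul_left_of_hasCompactSupport hφ.continuous hc)
      (h₂.2.integrable_smul_left_of_hasCompactSupport hφ.continuous hc),
      integral_add (h₁.1.integrable_smul_left_of_hasCompactSupport hD.continuous hDc)
      (h₂.1.integrable_smul_left_of_hasCompactSupport hD.continuous hDc),
      h₁.3 φ hφ hc, h₂.3 φ hφ hc, smul_add]

theorem HasWeakD.const_smul {d m : ℕ} {α : Fin d → ℕ} {u w : Space d → Vec m}
    (h : HasWeakD α u w) (c : ℂ) : HasWeakD α (c • u) (c • w) where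
  locallyIntegrable_left := h.1.smul c
  locallyIntegrable_right := h.2.smul c
  integral_eq φ hφ hc := by
    simp only [Pi.smul_apply, smul_comm _ c, integral_smul]
    rw [h.3 φ hφ hc, smul_comm]

theorem IsJet.add {d m : ℕ} {Ω : Submodule ℤ (Space d)} {F : Set (Space d)} {N : ℕ}
    {t : Space d} {f₁ f₂ : L2 m F} {u₁ u₂ : Space d → Vec m}
    {w₁ w₂ : (Fin d → ℕ) → Space d → Vec m}
    (h₁ : IsJet Ω F N t f₁ u₁ w₁) (h₂ : IsJet Ω F N t f₂ u₂ w₂) :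
    IsJet Ω F N t (f₁ + f₂) (u₁ + u₂) (w₁ + w₂) where
  extends_f := (Lp.coeFn_add f₁ f₂).trans (h₁.1.add h₂.1)
  quasiperiodic ω hω := by
    filter_upwards [h₁.2 ω hω, h₂.2 ω hω] with x hx₁ hx₂
    simp [hx₁, hx₂]
  memLp α hα := (h₁.3 α hα).add (h₂.3 α hα)
  hasWeakD α hα := (h₁.4 α hα).add (h₂.4 α hα)

theorem IsJet.const_smul {d m : ℕ} {Ω : Submodule ℤ (Space d)} {F : Set (Space d)} {N : ℕ}
    {t : Space d} {f : L2 m F} {u : Space d → Vec m} {w : (Fin d → ℕ) → Space d → Vec m}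
    (h : IsJet Ω F N t f u w) (c : ℂ) : IsJet Ω F N t (c • f) (c • u) (c • w) where
  extends_f := (Lp.coeFn_smul c f).trans (h.1.const_smul c)
  quasiperiodic ω hω := by
    filter_upwards [h.2 ω hω] with x hx
    simp only [Pi.smul_apply, hx]
    rw [smul_comm]
  memLp α hα := (h.3 α hα).const_smul c
  hasWeakD α hα := (h.4 α hα).const_smul c

theorem isJet_zero {d m : ℕ} (Ω : Submodule ℤ (Space d)) (F : Set (Space d)) (N : ℕ)
    (t : Space d) : IsJet (m := m) Ω F N t 0 0 0 where
  extends_f := Lp.coeFn_zero _ _ _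
  quasiperiodic ω hω := by simp
  memLp α hα := MemLp.zero
  hasWeakD α hα := ⟨locallyIntegrable_zero, locallyIntegrable_zero, by simp⟩

/-! ### The operators `T_t` -/

/-- The graph of `T_t`: the pairs `(f, g)` such that the `t`-quasiperiodic extension of `f` has
locally square integrable weak derivatives up to order `2s`, and
`g = ∑_{|α| = 2s} Q_α D_α f + ∑_{|α| ≤ 2s - 1} Q_α D_α f + B f` on `F`. -/
def blochGraph {d m : ℕ} {Ω : Submodule ℤ (Space d)} (F : Set (Space d)) (s : ℕ)
    (Q : DiffExpr d m Ω) (B : L2 m F →L[ℂ] L2 m F) (t : Space d) :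
    Submodule ℂ (L2 m F × L2 m F) where
  carrier := {p | ∃ u w, IsJet Ω F (2 * s) t p.1 u w ∧
    (p.2 : Space d → Vec m) =ᵐ[volume.restrict F] fun x => Q.apply s w x + B p.1 x}
  zero_mem' := by
    refine ⟨0, 0, isJet_zero Ω F (2 * s) t, ?_⟩
    have h0 := Lp.coeFn_zero (Vec m) 2 ((volume : Measure (Space d)).restrict F)
    simp only [Prod.fst_zero, Prod.snd_zero, map_zero]
    filter_upwards [h0] with x hx
    simp [DiffExpr.apply]
  add_mem' := by
    rintro ⟨f₁, g₁⟩ ⟨f₂, g₂⟩ ⟨u₁, w₁, h₁, e₁⟩ ⟨u₂, w₂, h₂, e₂⟩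
    refine ⟨_, _, h₁.add h₂, ?_⟩
    simp only [Prod.mk_add_mk, map_add] at e₁ e₂ ⊢
    filter_upwards [e₁, e₂, Lp.coeFn_add g₁ g₂, Lp.coeFn_add (B f₁) (B f₂)] with x a₁ a₂ a₃ a₄
    simp only [a₃, a₄, Pi.add_apply, a₁, a₂, DiffExpr.apply, map_add, Finset.sum_add_distrib]
    abel
  smul_mem' := by
    rintro c ⟨f, g⟩ ⟨u, w, h, e⟩
    refine ⟨_, _, h.const_smul c, ?_⟩
    simp only [Prod.smul_mk, map_smul] at e ⊢
    filter_upwards [e, Lp.coeFn_smul c g, Lp.coeFn_smul c (B f)] with x a₁ a₂ a₃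
    simp only [a₂, a₃, Pi.smul_apply, a₁, DiffExpr.apply, map_smul, Finset.smul_sum, smul_add]

/-- The operator `T_t` in `L₂ᵐ(F)` generated by the expression with coefficients `Q` and bounded
term `B` and by the quasiperiodic conditions `u(x + ω) = e^{i⟨t, ω⟩} u(x)`, `ω ∈ Ω`. -/
def blochOp {d m : ℕ} {Ω : Submodule ℤ (Space d)} (F : Set (Space d)) (s : ℕ)
    (Q : DiffExpr d m Ω) (B : L2 m F →L[ℂ] L2 m F) (t : Space d) : L2 m F →ₗ.[ℂ] L2 m F :=
  (blochGraph F s Q B t).toLinearPMap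

theorem IsQuasiperiodic.ae_eq_zero {d m : ℕ} {Ω : Submodule ℤ (Space d)} [DiscreteTopology Ω]
    {F : Set (Space d)} (hF : IsAddFundamentalDomain Ω F volume) {t : Space d}
    {u : Space d → Vec m} (hu : IsQuasiperiodic Ω t u) (h : u =ᵐ[volume.restrict F] 0) :
    u =ᵐ[volume] 0 := by
  have : Countable Ω := by
    have := TopologicalSpace.separableSpace_iff_countable (α := Ω)
    exact this.1 inferInstance
  have h1 : ∀ᵐ x, x ∈ F → u x = 0 := by
    have := (ae_restrict_iff'₀ hF.nullMeasurableSet).1 h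
    simpa using this
  have h2 : ∀ᵐ x, ∀ ω : Ω, x + (ω : Space d) ∈ F → u (x + (ω : Space d)) = 0 := by
    rw [ae_all_iff]
    intro ω
    exact (measurePreserving_add_right volume (ω : Space d)).quasiMeasurePreserving.ae h1
  have h3 : ∀ᵐ x, ∀ ω : Ω, u (x + (ω : Space d)) = expi t ω • u x := by
    rw [ae_all_iff]
    exact fun ω => hu ω ω.2
  filter_upwards [h2, h3, hF.ae_covers] with x hx2 hx3 ⟨ω, hω⟩
  have e : (ω +ᵥ x : Space d) = x + (ω : Space d) := add_comm _ _
  rw [e] at hω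
  have := (hx3 ω).symm.trans (hx2 ω hω)
  exact (smul_eq_zero.1 this).resolve_left (Complex.exp_ne_zero _)

theorem HasWeakD.ae_eq_zero {d m : ℕ} {α : Fin d → ℕ} {u w : Space d → Vec m}
    (h : HasWeakD α u w) (hu : u =ᵐ[volume] 0) : w =ᵐ[volume] 0 := by
  refine ae_eq_zero_of_integral_contDiff_smul_eq_zero h.2 fun g hg hgc => ?_
  have h1 := h.3 (fun x => (g x : ℂ)) (Complex.ofRealCLM.contDiff.comp hg)
    (hgc.comp_left (g := fun r : ℝ => (r : ℂ)) (by simp))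
  have h2 : ∫ x, mixedD α (fun x => (g x : ℂ)) x • u x = 0 := by
    rw [← integral_zero (Space d) (Vec m) (μ := volume)]
    refine integral_congr_ae ?_
    filter_upwards [hu] with x hx
    simp [hx]
  rw [h2, smul_zero] at h1
  rw [← h1]
  refine integral_congr_ae (Eventually.of_forall fun x => ?_)
  exact (Complex.coe_smul (g x) (w x)).symm

/-- `blochGraph` is the graph of an operator. -/
theorem blochGraph_single_valued {d m : ℕ} {Ω : Submodule ℤ (Space d)} [DiscreteTopology Ω]
    {F : Set (Space d)} (hF : IsAddFundamentalDomain Ω F volume) (s : ℕ)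
    (Q : DiffExpr d m Ω) (B : L2 m F →L[ℂ] L2 m F) (t : Space d) (p : L2 m F × L2 m F)
    (hp : p ∈ blochGraph F s Q B t) (h0 : p.1 = 0) : p.2 = 0 := by
  obtain ⟨f, g⟩ := p
  obtain ⟨u, w, h, e⟩ := hp
  simp only at h0 h e ⊢
  subst h0
  have hu : u =ᵐ[volume] 0 :=
    h.2.ae_eq_zero hF (h.1.symm.trans (Lp.coeFn_zero _ _ _))
  have hw : ∀ᵐ x ∂(volume.restrict F), ∀ α : Fin d → ℕ, ∑ i, α i ≤ 2 * s → w α x = 0 := by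
    rw [ae_all_iff]
    intro α
    by_cases hα : ∑ i, α i ≤ 2 * s
    · filter_upwards [ae_restrict_of_ae ((h.4 α hα).ae_eq_zero hu)] with x hx _ using hx
    · exact Eventually.of_forall fun x hx => absurd hx hα
  refine Lp.ext ?_
  have h0 := Lp.coeFn_zero (Vec m) 2 ((volume : Measure (Space d)).restrict F)
  rw [map_zero] at e
  filter_upwards [e, hw, h0] with x hx hwx hx0
  rw [hx, hx0]
  have a1 : ∀ α ∈ multiIndices d (2 * s),
      ((Q.top α).map Complex.ofReal).toEuclideanLin (w α x) = 0 := fun α hα => by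
    rw [hwx α (mem_multiIndices.1 hα).le, map_zero]
  have a2 : ∀ α ∈ multiIndicesLT d (2 * s), (Q.low α x).toEuclideanLin (w α x) = 0 :=
    fun α hα => by rw [hwx α (mem_multiIndicesLT.1 hα).le, map_zero]
  simp [DiffExpr.apply, Finset.sum_eq_zero a1, Finset.sum_eq_zero a2]

theorem blochOp_graph {d m : ℕ} {Ω : Submodule ℤ (Space d)} [DiscreteTopology Ω]
    {F : Set (Space d)} (hF : IsAddFundamentalDomain Ω F volume) (s : ℕ)
    (Q : DiffExpr d m Ω) (B : L2 m F →L[ℂ] L2 m F) (t : Space d) :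
    (blochOp F s Q B t).graph = blochGraph F s Q B t :=
  Submodule.toLinearPMap_graph_eq _ (blochGraph_single_valued hF s Q B t)

/-! ### Operators with compact resolvent and their eigenvalues -/

variable {H : Type*} [NormedAddCommGroup H] [InnerProductSpace ℂ H]

/-- The class `SBC(H)`: self-adjoint operators that are bounded below and have compact
resolvent. -/
structure IsSBC [CompleteSpace H] (A : H →ₗ.[ℂ] H) : Prop where
  selfAdjoint : IsSelfAdjoint A
  boundedBelow : ∃ c : ℝ, ∀ f : A.domain, c * ‖f‖ ^ 2 ≤ (inner ℂ (f : H) (A f)).re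
  compactResolvent : ∃ (z : ℂ) (R : H →L[ℂ] H), IsCompactOperator R ∧
    (∀ f : A.domain, R (A f - z • (f : H)) = f) ∧
    ∀ g : H, ∃ h : R g ∈ A.domain, A ⟨R g, h⟩ - z • R g = g

/-- The eigenspace `{f ∈ D(A) : A f = μ f}`. -/
def eigenspace (A : H →ₗ.[ℂ] H) (μ : ℝ) : Submodule ℂ H where
  carrier := {f | ∃ h : f ∈ A.domain, A ⟨f, h⟩ = (μ : ℂ) • f}
  zero_mem' := ⟨A.domain.zero_mem, by
    rw [smul_zero]; exact A.map_zero⟩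
  add_mem' := by
    rintro f g ⟨hf, ef⟩ ⟨hg, eg⟩
    refine ⟨A.domain.add_mem hf hg, ?_⟩
    rw [smul_add, ← ef, ← eg, ← A.map_add]
    rfl
  smul_mem' := by
    rintro c f ⟨hf, ef⟩
    refine ⟨A.domain.smul_mem c hf, ?_⟩
    rw [smul_comm, ← ef, ← A.map_smul]
    rfl

/-- The `n`-th eigenvalue (`n ≥ 1`) of `A` in nondecreasing order, counted with multiplicity: the
least `μ` such that at least `n` eigenvalues, counted with multiplicity, are `≤ μ`. -/
def eigenvalue (A : H →ₗ.[ℂ] H) (n : ℕ) : ℝ :=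
  sInf {μ : ℝ | (n : Cardinal) ≤ Module.rank ℂ ↥(⨆ ν : ℝ, ⨆ _ : ν ≤ μ, eigenspace A ν)}

/-- `μ` is an eigenvalue of `A` of multiplicity one. -/
def IsSimpleEigenvalue (A : H →ₗ.[ℂ] H) (μ : ℝ) : Prop :=
  Module.finrank ℂ (eigenspace A μ) = 1

/-- `ψ` is a normalized eigenfunction of `A` for the eigenvalue `μ`. -/
def IsNormalizedEigenfunction (A : H →ₗ.[ℂ] H) (μ : ℝ) (ψ : H) : Prop :=
  ψ ∈ eigenspace A μ ∧ ‖ψ‖ = 1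

/-- The inner product `(ψ, e^{i⟨t, x⟩} v)` of `L₂ᵐ(F)`, linear in `ψ`. -/
def planeWaveCoeff {d m : ℕ} {F : Set (Space d)} (v : Vec m) (t : Space d) (ψ : L2 m F) : ℂ :=
  ∫ x in F, inner ℂ (expi t x • v) (ψ x)

end Bloch

end

/-! The domains of the operators `T_t` change with `t`, so `T_t` and `T_a` are compared only after a
gauge transformation. Multiplication `M` by `e^{i⟨t - a, x⟩}` is unitary on `L₂ᵐ(F)` and carries the
quasiperiodic conditions for `a` to those for `t`, hence `D(T_a)` onto `D(T_t)`. By the Leibniz rule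
`M⁻¹ T_t M - T_a` consists of derivatives of order at most `2s - 1`, with coefficients that vanish
as `t → a`, and of the bounded operator `M⁻¹ B_t M - B_a`, which is small because `F` is bounded and
`B` is norm continuous. The a priori estimate (ii) controls precisely these derivatives by `‖T_a f‖
+ ‖f‖`. So the difference has a small relative bound (`exists_relClose_blochOp`).

The rest is perturbation theory for self-adjoint operators with compact resolvent, done with
orthonormal eigenbases. A dimension count compares the eigenvalue counting functions of two
relatively close operators (`Eigenbasis.ncard_le_ncard`). Since the counting function of `T_a` jumps
by exactly one at the isolated eigenvalue `λ_n(a)`, that of `T_t` jumps by one nearby, so `λ_n(t)`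
is simple and close to `λ_n(a)` (`exists_eigenvalue_close`). An eigenvector of `T_t`, carried back
by `M⁻¹`, almost solves the eigenvalue equation of `T_a`, and the spectral gap forces it close to
the eigenline of `T_a` (`exists_eigenfunction_close`).

It remains to control the phase. `M` carries the plane wave at `a` to the plane wave at `t`, so
after the transport both phases are normalized by the same functional. That functional does not
vanish on the eigenvector, and two nearly parallel unit vectors with the same phase are close
(`norm_sub_le_of_arg_eq_zero`). -/

noncomputable section

namespace Bloch

/-! ### Eigenbases of self-adjoint operators with compact resolvent. -/

section Spectral

variable {H : Type*} [NormedAddCommGroup H] [InnerProductSpace ℂ H]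

/-- A Hilbert basis of eigenvectors of `A`, with finitely many eigenvalues below each number. -/
structure Eigenbasis (A : H →ₗ.[ℂ] H) (ι : Type) where
  /-- The eigenvectors. -/
  basis : HilbertBasis ι ℂ H
  /-- The eigenvalues. -/
  val : ι → ℝ
  mem : ∀ i, basis i ∈ A.domain
  apply_basis : ∀ i, A ⟨basis i, mem i⟩ = (val i : ℂ) • basis i
  finite : ∀ μ, {i | val i ≤ μ}.Finite

theorem IsSBC.isFormalAdjoint [CompleteSpace H] {A : H →ₗ.[ℂ] H} (hA : IsSBC A) (f g : A.domain) :
    inner ℂ (A f) (g : H) = inner ℂ (f : H) (A g) := by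
  have h := LinearPMap.adjoint_isFormalAdjoint hA.selfAdjoint.dense_domain
  rw [LinearPMap.isSelfAdjoint_def.1 hA.selfAdjoint] at h
  exact h f g

/-- The resolvent of an operator of class `SBC` at a point below its spectrum. -/
theorem IsSBC.exists_real_resolvent [CompleteSpace H] {A : H →ₗ.[ℂ] H} (hA : IsSBC A) :
    ∃ (K : ℝ) (R : H →L[ℂ] H), IsCompactOperator R ∧
      (∀ f : A.domain, ‖(f : H)‖ ^ 2 ≤ (inner ℂ (f : H) (A f)).re + K * ‖(f : H)‖ ^ 2) ∧
      ∀ g : H, ∃ h : R g ∈ A.domain, A ⟨R g, h⟩ + (K : ℂ) • R g = g := by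
  obtain ⟨c, hc⟩ := hA.boundedBelow
  obtain ⟨z, R, hR, hleft, hright⟩ := hA.compactResolvent
  have hpos : ∀ f : A.domain,
      ‖(f : H)‖ ^ 2 ≤ (inner ℂ (f : H) (A f)).re + (1 - c) * ‖(f : H)‖ ^ 2 := by
    intro f
    have : c * ‖(f : H)‖ ^ 2 ≤ _ := hc f
    linarith
  -- This shift gives `A + K ≥ 1`. As `(A + K) R = 1 + (K + z) R`, inverting the right side moves
  -- the resolvent from `z` to the real point `-K`.
  set K : ℝ := 1 - c with hK
  -- `S = 1 + (K + z) R` is invertible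
  set S : H →L[ℂ] H := 1 + ((K : ℂ) + z) • R with hS
  have hAS : ∀ g : H, ∃ h : R g ∈ A.domain, A ⟨R g, h⟩ + (K : ℂ) • R g = S g := by
    intro g
    obtain ⟨h, e⟩ := hright g
    refine ⟨h, ?_⟩
    have : A ⟨R g, h⟩ = g + z • R g := sub_eq_iff_eq_add.1 e
    rw [this]
    simp only [hS, add_apply, one_apply_eq_self,
      smul_apply, add_smul]
    abel
  have hinj : ∀ g, S g = 0 → g = 0 := by
    intro g hg
    obtain ⟨h, e⟩ := hAS g
    rw [hg] at e
    have h1 := hpos ⟨R g, h⟩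
    rw [eq_neg_of_add_eq_zero_left e] at h1
    simp only [inner_neg_right, inner_smul_right, inner_self_eq_norm_sq_to_K] at h1
    have h2 : (-((K : ℂ) * ((‖R g‖ : ℝ) : ℂ) ^ 2)).re = -(K * ‖R g‖ ^ 2) := by
      norm_cast
    have h3 : ‖R g‖ ^ 2 ≤ 0 := by
      have := h1.trans_eq (congrArg (· + K * ‖R g‖ ^ 2) h2)
      simpa using this
    have h4 : R g = 0 := by
      have := pow_eq_zero_iff (two_ne_zero) |>.1 (le_antisymm h3 (sq_nonneg ‖R g‖))
      exact norm_eq_zero.1 this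
    have : S g = g := by simp [hS, h4]
    rw [← this, hg]
  have hunit : IsUnit S := by
    by_cases hKz : (K : ℂ) + z = 0
    · simp [hS, hKz]
    · have hne : -((K : ℂ) + z)⁻¹ ≠ 0 := neg_ne_zero.2 (inv_ne_zero hKz)
      -- Fredholm alternative: an eigenvector of `R` for `-(K + z)⁻¹` would be a nonzero element of
      -- the kernel of `S`.
      rcases hR.hasEigenvalue_or_mem_resolventSet hne with h | h
      · exfalso
        obtain ⟨g, hg⟩ := h.exists_hasEigenvector
        refine hg.2 (hinj g ?_)
        have : R g = -((K : ℂ) + z)⁻¹ • g := hg.apply_eq_smul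
        simp only [hS, add_apply, one_apply_eq_self,
          smul_apply, this, smul_smul]
        rw [mul_neg, mul_inv_cancel₀ hKz]
        simp
      · rw [spectrum.mem_resolventSet_iff] at h
        have h2 := h.smul (Units.mk0 _ (neg_ne_zero.2 hKz))
        convert h2 using 1
        rw [hS, smul_sub, Algebra.algebraMap_eq_smul_one, Units.smul_def, Units.smul_def,
          smul_smul]
        simp only [Units.val_mk0, neg_mul_neg, mul_inv_cancel₀ hKz, one_smul, neg_smul,
          sub_neg_eq_add]
  obtain ⟨u, hu⟩ := hunit
  refine ⟨K, R * (↑u⁻¹ : H →L[ℂ] H), hR.comp_clm _, hpos, fun g => ?_⟩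
  obtain ⟨h, e⟩ := hAS ((↑u⁻¹ : H →L[ℂ] H) g)
  refine ⟨h, e.trans ?_⟩
  rw [← hu, ← mul_apply_eq_comp, Units.mul_inv, one_apply_eq_self]

/-- A compact operator has finitely many orthonormal eigenvectors with eigenvalues away from `0`. -/
theorem finite_setOf_le_norm_of_isCompactOperator {ι : Type*} {R : H →L[ℂ] H}
    (hR : IsCompactOperator R) {v : ι → H} (hv : Orthonormal ℂ v) {r : ι → ℂ}
    (hr : ∀ i, R (v i) = r i • v i) {ρ : ℝ} (hρ : 0 < ρ) : {i | ρ ≤ ‖r i‖}.Finite := by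
  by_contra hinf
  obtain ⟨K, hK, hRK⟩ := hR.image_closedBall_subset_compact 1
  set f := Set.Infinite.natEmbedding _ hinf
  obtain ⟨y, -, ψ, hψ, hlim⟩ := hK.tendsto_subseq (x := fun n => R (v (f n)))
    (fun n => hRK ⟨v (f n), by simp [hv.1], rfl⟩)
  have hc := hlim.cauchySeq
  rw [Metric.cauchySeq_iff'] at hc
  obtain ⟨N, hN⟩ := hc ρ hρ
  have h1 := hN (N + 1) (by omega)
  have hne : (f (ψ (N + 1)) : ι) ≠ f (ψ N) := fun h =>
    absurd (hψ.injective (f.injective (Subtype.ext h))) (by omega)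
  have h2 : ρ ≤ ‖r (f (ψ (N + 1)))‖ := (f (ψ (N + 1))).2
  -- By orthogonality the images are at distance at least `ρ` from each other, so no subsequence of
  -- them is Cauchy.
  have h3 : inner ℂ (r (f (ψ (N + 1))) • v (f (ψ (N + 1)))) (r (f (ψ N)) • v (f (ψ N))) = 0 := by
    rw [inner_smul_left, inner_smul_right, hv.2 hne]
    simp
  rw [dist_eq_norm] at h1
  simp only [Function.comp, hr] at h1
  have h5 := @norm_sub_sq ℂ H _ _ _
    (r (f (ψ (N + 1))) • v (f (ψ (N + 1)))) (r (f (ψ N)) • v (f (ψ N)))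
  rw [h3] at h5
  simp only [norm_smul, hv.1, mul_one, map_zero, mul_zero, sub_zero] at h5
  nlinarith [norm_nonneg (r (f (ψ (N + 1))) • v (f (ψ (N + 1))) - r (f (ψ N)) • v (f (ψ N))),
    sq_nonneg ‖r (f (ψ N))‖]

/-- The spectral theorem for the compact symmetric operator `R = (A + K)⁻¹`. Injectivity of `R`
removes the eigenvalue `0`, so all its eigenspaces are finite-dimensional; an eigenvalue `r` of `R`
becomes the eigenvalue `r⁻¹ - K` of `A`. -/
theorem IsSBC.exists_eigenbasis [CompleteSpace H] {A : H →ₗ.[ℂ] H} (hA : IsSBC A) :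
    ∃ ι : Type, Nonempty (Eigenbasis A ι) := by
  obtain ⟨K, R, hR, hpos, hres⟩ := hA.exists_real_resolvent
  have hsymm : (R : H →ₗ[ℂ] H).IsSymmetric := by
    intro f g
    obtain ⟨hf, ef⟩ := hres f
    obtain ⟨hg, eg⟩ := hres g
    have h := hA.isFormalAdjoint ⟨R f, hf⟩ ⟨R g, hg⟩
    have h1 : A ⟨R f, hf⟩ = f - (K : ℂ) • R f := eq_sub_of_add_eq ef
    have h2 : A ⟨R g, hg⟩ = g - (K : ℂ) • R g := eq_sub_of_add_eq eg
    rw [h1, h2] at h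
    simp only [inner_sub_left, inner_sub_right, inner_smul_left, inner_smul_right,
      Complex.conj_ofReal] at h
    exact (sub_left_inj.1 h).symm
  have hinj : ∀ g, R g = 0 → g = 0 := by
    intro g hg
    obtain ⟨h, e⟩ := hres g
    have : (⟨R g, h⟩ : A.domain) = 0 := Subtype.ext hg
    rw [this, hg] at e
    simpa using e.symm
  let V : ℂ → Submodule ℂ H := fun μ => Module.End.eigenspace (R : Module.End ℂ H) μ
  have hV0 : V 0 = ⊥ := by
    refine (Submodule.eq_bot_iff _).2 fun g hg => hinj g ?_
    simpa using Module.End.mem_eigenspace_iff.1 hg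
  have hfin : ∀ μ, FiniteDimensional ℂ (V μ) := by
    intro μ
    by_cases hμ : μ = 0
    · rw [hμ, hV0]; infer_instance
    · exact ContinuousLinearMap.finite_dimensional_eigenspace hR μ hμ
  let v : (Σ μ : ℂ, Fin (Module.finrank ℂ (V μ))) → H :=
    fun i => (stdOrthonormalBasis ℂ (V i.1) i.2 : V i.1)
  have hv : Orthonormal ℂ v :=
    hsymm.orthogonalFamily_eigenspaces.orthonormal_sigma_orthonormal
      (v_family := fun μ i => stdOrthonormalBasis ℂ (V μ) i)
      fun μ => (stdOrthonormalBasis ℂ (V μ)).orthonormal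
  have hspan : (Submodule.span ℂ (Set.range v))ᗮ = ⊥ := by
    rw [eq_bot_iff, ← ContinuousLinearMap.orthogonalComplement_iSup_eigenspaces_eq_bot hR hsymm]
    refine Submodule.orthogonal_le (iSup_le fun μ => ?_)
    intro f hf
    have h := (stdOrthonormalBasis ℂ (V μ)).sum_repr ⟨f, hf⟩
    have h' := congrArg (Subtype.val) h
    rw [← show _ = f from h']
    simp only [Submodule.coe_sum, Submodule.coe_smul]
    exact Submodule.sum_mem _ fun i _ => Submodule.smul_mem _ _
      (Submodule.subset_span ⟨⟨μ, i⟩, rfl⟩)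
  have hRv : ∀ i, R (v i) = i.1 • v i := fun i =>
    Module.End.mem_eigenspace_iff.1 (stdOrthonormalBasis ℂ (V i.1) i.2).2
  have hne : ∀ i : (Σ μ : ℂ, Fin (Module.finrank ℂ (V μ))), i.1 ≠ 0 := by
    intro i hi
    have h := hRv i
    rw [hi, zero_smul] at h
    exact hv.ne_zero i (hinj _ h)
  have hreal : ∀ i : (Σ μ : ℂ, Fin (Module.finrank ℂ (V μ))), ((i.1.re : ℝ) : ℂ) = i.1 := by
    intro i
    refine Complex.conj_eq_iff_re.1 (hsymm.conj_eigenvalue_eq_self ?_)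
    exact Module.End.hasEigenvalue_of_hasEigenvector (x := v i)
      ⟨Module.End.mem_eigenspace_iff.2 (hRv i), hv.ne_zero i⟩
  have hdom : ∀ i, ∃ h : v i ∈ A.domain, A ⟨v i, h⟩ = (((i.1.re)⁻¹ - K : ℝ) : ℂ) • v i := by
    intro i
    obtain ⟨h, e⟩ := hres (i.1⁻¹ • v i)
    have e1 : R (i.1⁻¹ • v i) = v i := by
      rw [map_smul, hRv, smul_smul, inv_mul_cancel₀ (hne i), one_smul]
    have h' : v i ∈ A.domain := e1 ▸ h
    refine ⟨h', ?_⟩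
    have e2 : (⟨R (i.1⁻¹ • v i), h⟩ : A.domain) = ⟨v i, h'⟩ := Subtype.ext e1
    rw [e2, e1] at e
    rw [eq_sub_of_add_eq e, ← sub_smul]
    push_cast
    rw [hreal]
  refine ⟨_, ⟨{ basis := HilbertBasis.mkOfOrthogonalEqBot hv hspan
                val := fun i => (i.1.re)⁻¹ - K
                mem := ?_
                apply_basis := ?_
                finite := ?_ }⟩⟩
  · intro i
    rw [HilbertBasis.coe_mkOfOrthogonalEqBot]
    exact (hdom i).1
  · intro i
    simp only [HilbertBasis.coe_mkOfOrthogonalEqBot]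
    exact (hdom i).2
  · intro μ
    -- For an eigenvalue `r` of `R`, `r⁻¹ - K ≤ μ` forces `r⁻¹ ≤ |μ + K| + 1`; the summand `1` keeps
    -- the threshold positive when `μ = -K`.
    refine (finite_setOf_le_norm_of_isCompactOperator hR hv hRv
      (ρ := (|μ + K| + 1)⁻¹) (by positivity)).subset ?_
    intro i hi
    have hi : (i.1.re)⁻¹ - K ≤ μ := hi
    have h1 := hpos ⟨v i, (hdom i).1⟩
    rw [(hdom i).2, inner_smul_right, inner_self_eq_norm_sq_to_K, hv.1] at h1
    have h2 : 1 ≤ (i.1.re)⁻¹ := by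
      simp only [Complex.coe_algebraMap, Complex.ofReal_one, one_pow, mul_one,
        Complex.ofReal_re] at h1
      linarith
    have h3 : 0 < i.1.re := inv_pos.1 (by linarith)
    show _ ≤ ‖i.1‖
    rw [← hreal i, Complex.norm_real, Real.norm_of_nonneg h3.le]
    refine inv_le_of_inv_le₀ h3 ?_
    have := le_abs_self (μ + K)
    linarith

namespace Eigenbasis

variable {A : H →ₗ.[ℂ] H} {ι : Type} (b : Eigenbasis A ι)

theorem basis_mem_eigenspace (i : ι) : b.basis i ∈ eigenspace A (b.val i) :=
  ⟨b.mem i, b.apply_basis i⟩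

/-- By symmetry `A` acts diagonally on the coefficients of every vector of its domain, not only on
finite combinations of eigenvectors. All estimates of `A f` below are Parseval's identity combined
with this. -/
theorem inner_basis_apply [CompleteSpace H] (hA : IsSBC A) (i : ι) (f : A.domain) :
    inner ℂ (b.basis i) (A f) = b.val i * inner ℂ (b.basis i) (f : H) := by
  have h := hA.isFormalAdjoint ⟨b.basis i, b.mem i⟩ f
  rw [b.apply_basis, inner_smul_left, Complex.conj_ofReal] at h
  exact h.symm

theorem re_inner_mul_inner_symm (f g : H) :
    (inner ℂ f g * inner ℂ g f).re = ‖inner ℂ g f‖ ^ 2 := by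
  rw [← inner_conj_symm, mul_comm, Complex.mul_conj, Complex.normSq_eq_norm_sq, Complex.ofReal_re]

theorem hasSum_norm_sq (f : H) : HasSum (fun i => ‖inner ℂ (b.basis i) f‖ ^ 2) (‖f‖ ^ 2) := by
  have h := Complex.reCLM.hasSum (b.basis.hasSum_inner_mul_inner f f)
  simp only [Complex.reCLM_apply] at h
  convert h using 1
  · ext i
    rw [re_inner_mul_inner_symm]
  · rw [inner_self_eq_norm_sq_to_K]; norm_cast

theorem hasSum_norm_sq_apply_sub [CompleteSpace H] (hA : IsSBC A) (f : A.domain) (μ : ℝ) :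
    HasSum (fun i => (b.val i - μ) ^ 2 * ‖inner ℂ (b.basis i) (f : H)‖ ^ 2)
      (‖A f - (μ : ℂ) • (f : H)‖ ^ 2) := by
  convert b.hasSum_norm_sq (A f - (μ : ℂ) • (f : H)) using 1
  ext i
  rw [inner_sub_right, b.inner_basis_apply hA, inner_smul_right, ← sub_mul, norm_mul, mul_pow,
    ← Complex.ofReal_sub, Complex.norm_real, Real.norm_eq_abs, sq_abs]

theorem hasSum_form [CompleteSpace H] (hA : IsSBC A) (f : A.domain) :
    HasSum (fun i => b.val i * ‖inner ℂ (b.basis i) (f : H)‖ ^ 2)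
      (inner ℂ (f : H) (A f)).re := by
  have h := Complex.reCLM.hasSum (b.basis.hasSum_inner_mul_inner (f : H) (A f))
  simp only [Complex.reCLM_apply] at h
  convert h using 1
  ext i
  rw [b.inner_basis_apply hA, mul_left_comm, Complex.re_ofReal_mul, re_inner_mul_inner_symm]

/-- Only the indices that occur in `f` are constrained, so the bound applies to vectors orthogonal
to the eigenvectors below `μ`. -/
theorem le_form [CompleteSpace H] (hA : IsSBC A) (f : A.domain) {μ : ℝ}
    (h : ∀ i, inner ℂ (b.basis i) (f : H) ≠ 0 → μ ≤ b.val i) :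
    μ * ‖(f : H)‖ ^ 2 ≤ (inner ℂ (f : H) (A f)).re := by
  refine hasSum_le (fun i => ?_) ((b.hasSum_norm_sq (f : H)).mul_left μ) (b.hasSum_form hA f)
  by_cases hi : inner ℂ (b.basis i) (f : H) = 0
  · simp [hi]
  · exact mul_le_mul_of_nonneg_right (h i hi) (sq_nonneg _)

theorem form_le [CompleteSpace H] (hA : IsSBC A) (f : A.domain) {μ : ℝ}
    (h : ∀ i, inner ℂ (b.basis i) (f : H) ≠ 0 → b.val i ≤ μ) :
    (inner ℂ (f : H) (A f)).re ≤ μ * ‖(f : H)‖ ^ 2 := by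
  refine hasSum_le (fun i => ?_) (b.hasSum_form hA f) ((b.hasSum_norm_sq (f : H)).mul_left μ)
  by_cases hi : inner ℂ (b.basis i) (f : H) = 0
  · simp [hi]
  · exact mul_le_mul_of_nonneg_right (h i hi) (sq_nonneg _)

theorem norm_apply_le [CompleteSpace H] (hA : IsSBC A) (f : A.domain) {L : ℝ} (hL : 0 ≤ L)
    (h : ∀ i, inner ℂ (b.basis i) (f : H) ≠ 0 → |b.val i| ≤ L) :
    ‖A f‖ ≤ L * ‖(f : H)‖ := by
  refine le_of_sq_le_sq ?_ (by positivity)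
  have h1 := b.hasSum_norm_sq_apply_sub hA f 0
  simp only [Complex.ofReal_zero, zero_smul, sub_zero] at h1
  rw [mul_pow]
  refine hasSum_le (fun i => ?_) h1 ((b.hasSum_norm_sq (f : H)).mul_left (L ^ 2))
  by_cases hi : inner ℂ (b.basis i) (f : H) = 0
  · simp [hi]
  · exact mul_le_mul_of_nonneg_right (sq_le_sq' (abs_le.1 (h i hi)).1 (abs_le.1 (h i hi)).2)
      (sq_nonneg _)

theorem le_norm_apply_sub [CompleteSpace H] (hA : IsSBC A) (f : A.domain) {g μ : ℝ} (hg : 0 ≤ g)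
    (h : ∀ i, inner ℂ (b.basis i) (f : H) ≠ 0 → g ≤ |b.val i - μ|) :
    g * ‖(f : H)‖ ≤ ‖A f - (μ : ℂ) • (f : H)‖ := by
  refine le_of_sq_le_sq ?_ (norm_nonneg _)
  rw [mul_pow]
  refine hasSum_le (fun i => ?_) ((b.hasSum_norm_sq (f : H)).mul_left (g ^ 2))
    (b.hasSum_norm_sq_apply_sub hA f μ)
  by_cases hi : inner ℂ (b.basis i) (f : H) = 0
  · simp [hi]
  · refine mul_le_mul_of_nonneg_right ?_ (sq_nonneg _)
    rw [← sq_abs (b.val i - μ)]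
    exact pow_le_pow_left₀ hg (h i hi) 2

theorem inner_eq_zero_of_mem_span {S : Set ι} {f : H}
    (hf : f ∈ Submodule.span ℂ (b.basis '' S)) {i : ι} (hi : i ∉ S) :
    inner ℂ (b.basis i) f = 0 := by
  have h : Submodule.span ℂ (b.basis '' S) ≤ (Submodule.span ℂ {b.basis i})ᗮ := by
    refine Submodule.span_le.2 ?_
    rintro _ ⟨j, hj, rfl⟩
    rw [SetLike.mem_coe, Submodule.mem_orthogonal_singleton_iff_inner_right]
    exact b.basis.orthonormal.2 fun h => hi (h ▸ hj)
  exact (Submodule.mem_orthogonal_singleton_iff_inner_right).1 (h hf)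

/-- Finiteness of `S` turns the expansion of `f` into a finite sum, so the algebraic span suffices
without closure. -/
theorem mem_span_of_inner_eq_zero {S : Set ι} (hS : S.Finite) {f : H}
    (h : ∀ i ∉ S, inner ℂ (b.basis i) f = 0) : f ∈ Submodule.span ℂ (b.basis '' S) := by
  have h1 := b.basis.hasSum_repr f
  have h2 : HasSum (fun i => b.basis.repr f i • b.basis i)
      (∑ i ∈ hS.toFinset, b.basis.repr f i • b.basis i) := by
    refine hasSum_sum_of_ne_finset_zero fun i hi => ?_
    rw [b.basis.repr_apply_apply, h i (by simpa using hi), zero_smul]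
  rw [h1.unique h2]
  exact Submodule.sum_mem _ fun i hi => Submodule.smul_mem _ _
    (Submodule.subset_span ⟨i, by simpa using hi, rfl⟩)

theorem eigenspace_eq [CompleteSpace H] (hA : IsSBC A) (μ : ℝ) :
    eigenspace A μ = Submodule.span ℂ (b.basis '' {i | b.val i = μ}) := by
  refine le_antisymm ?_ (Submodule.span_le.2 ?_)
  · rintro f ⟨hf, e⟩
    refine b.mem_span_of_inner_eq_zero ((b.finite μ).subset fun i hi => le_of_eq hi) fun i hi => ?_
    have h := b.inner_basis_apply hA i ⟨f, hf⟩
    rw [e, inner_smul_right] at h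
    by_contra hne
    exact hi (Complex.ofReal_injective (mul_right_cancel₀ hne h)).symm
  · rintro _ ⟨i, rfl, rfl⟩
    exact b.basis_mem_eigenspace i

theorem iSup_eigenspace_eq [CompleteSpace H] (hA : IsSBC A) (μ : ℝ) :
    ⨆ ν : ℝ, ⨆ _ : ν ≤ μ, eigenspace A ν = Submodule.span ℂ (b.basis '' {i | b.val i ≤ μ}) := by
  refine le_antisymm (iSup₂_le fun ν hν => ?_) (Submodule.span_le.2 ?_)
  · rw [b.eigenspace_eq hA]
    exact Submodule.span_mono (Set.image_mono fun i (hi : b.val i = ν) => (hi ▸ hν : b.val i ≤ μ))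
  · rintro _ ⟨i, hi, rfl⟩
    exact (le_iSup₂ (f := fun ν (_ : ν ≤ μ) => eigenspace A ν) (b.val i) hi)
      (b.basis_mem_eigenspace i)

theorem rank_span_image {S : Set ι} (hS : S.Finite) :
    Module.rank ℂ (Submodule.span ℂ (b.basis '' S)) = S.ncard := by
  have hinj : Function.Injective b.basis := b.basis.orthonormal.linearIndependent.injective
  rw [rank_span_set (b.basis.orthonormal.linearIndependent.linearIndepOn_id.mono
    (Set.image_subset_range _ _)), ← Set.cast_ncard (hS.image _), Set.ncard_image_of_injective _ hinj]

theorem finrank_eigenspace [CompleteSpace H] (hA : IsSBC A) (μ : ℝ) :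
    Module.finrank ℂ (eigenspace A μ) = {i | b.val i = μ}.ncard := by
  rw [b.eigenspace_eq hA]
  exact Module.finrank_eq_of_rank_eq
    (b.rank_span_image ((b.finite μ).subset fun i hi => le_of_eq hi))

/-- This replaces ranks of eigenspaces by the counting function of the eigenbasis, on which the
comparison of operators takes place. -/
theorem eigenvalue_eq_sInf [CompleteSpace H] (hA : IsSBC A) (n : ℕ) :
    eigenvalue A n = sInf {μ : ℝ | n ≤ {i | b.val i ≤ μ}.ncard} := by
  unfold eigenvalue
  congr 1
  ext μ
  simp only [Set.mem_ofPred_eq]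
  rw [b.iSup_eigenspace_eq hA, b.rank_span_image (b.finite μ), Nat.cast_le]

end Eigenbasis

end Spectral

/-! ### Stability of simple eigenvalues under relatively small perturbations. -/

section Perturbation

variable {H : Type*} [NormedAddCommGroup H] [InnerProductSpace ℂ H]

/-- The isometry `M` maps the domain of `A` to that of `A'` and intertwines `A` and `A'` up to an
error with relative bound `η`. -/
def RelClose (η : ℝ) (A A' : H →ₗ.[ℂ] H) (M : H ≃ₗᵢ[ℂ] H) : Prop :=
  ∀ f : A.domain, ∃ h : M f ∈ A'.domain, ‖A' ⟨M f, h⟩ - M (A f)‖ ≤ η * (‖A f‖ + ‖(f : H)‖)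

theorem RelClose.mono {η η' : ℝ} (hη : η ≤ η') {A A' : H →ₗ.[ℂ] H} {M : H ≃ₗᵢ[ℂ] H}
    (h : RelClose η A A' M) : RelClose η' A A' M := fun f => by
  obtain ⟨hf, e⟩ := h f
  exact ⟨hf, e.trans (mul_le_mul_of_nonneg_right hη (by positivity))⟩

/-- If `M` maps the domain of `A` onto that of `A'`, closeness can be reversed. -/
theorem RelClose.symm {η : ℝ} {A A' : H →ₗ.[ℂ] H} {M : H ≃ₗᵢ[ℂ] H} (h0 : 0 ≤ η) (h1 : η ≤ 1 / 2)
    (h : RelClose η A A' M) (hdom : ∀ g ∈ A'.domain, M.symm g ∈ A.domain) :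
    RelClose (2 * η) A' A M.symm := by
  intro g
  have hg := hdom g g.2
  refine ⟨hg, ?_⟩
  obtain ⟨hf, e⟩ := h ⟨M.symm g, hg⟩
  have e1 : (⟨M ((⟨M.symm g, hg⟩ : A.domain) : H), hf⟩ : A'.domain) = g :=
    Subtype.ext (M.apply_symm_apply _)
  rw [e1] at e
  set y := A ⟨M.symm g, hg⟩
  have e2 : ‖y - M.symm (A' g)‖ = ‖A' g - M y‖ := by
    rw [← M.norm_map, map_sub, M.apply_symm_apply, norm_sub_rev]
  -- The error is bounded by `η (‖y‖ + ‖g‖)`, and `‖y‖` contains the error again; as `η ≤ 1 / 2`,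
  -- that part is absorbed at the cost of a factor `2`.
  have e3 : ‖y‖ ≤ ‖A' g‖ + ‖A' g - M y‖ := by
    rw [← M.norm_map y]
    have := norm_sub_norm_le (M y) (A' g)
    rw [norm_sub_rev] at this
    linarith
  have e4 : ‖M.symm (g : H)‖ = ‖(g : H)‖ := M.symm.norm_map _
  simp only [e4] at e
  rw [e2]
  nlinarith [norm_nonneg (A' g), norm_nonneg (g : H), norm_nonneg (A' g - M y)]

namespace Eigenbasis

variable {A A' : H →ₗ.[ℂ] H} {ι ι' : Type} (b : Eigenbasis A ι)
  (b' : Eigenbasis A' ι')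

theorem exists_lower_bound : ∃ K : ℝ, 0 ≤ K ∧ ∀ i, -K ≤ b.val i := by
  obtain ⟨K, hK⟩ := ((b.finite 0).image b.val).bddBelow
  refine ⟨|K|, abs_nonneg K, fun i => ?_⟩
  by_cases hi : b.val i ≤ 0
  · exact (neg_abs_le K).trans (hK ⟨i, hi, rfl⟩)
  · have := abs_nonneg K
    linarith [not_le.1 hi]

theorem infinite_index (b : Eigenbasis A ι) (hinf : ¬ FiniteDimensional ℂ H) : Infinite ι := by
  by_contra h
  rw [not_infinite_iff_finite] at h
  refine hinf ?_
  have h1 : (⊤ : Submodule ℂ H) = Submodule.span ℂ (b.basis '' Set.univ) := by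
    refine (eq_top_iff.2 fun f _ => ?_).symm
    exact b.mem_span_of_inner_eq_zero Set.finite_univ fun i hi => absurd (Set.mem_univ i) hi
  have h2 : FiniteDimensional ℂ (⊤ : Submodule ℂ H) := by
    rw [h1]
    exact FiniteDimensional.span_of_finite ℂ (Set.finite_univ.image _)
  exact Module.finite_def.2 ((Submodule.fg_iff_finiteDimensional _).2 h2)

variable [CompleteSpace H]

/-- A transported eigenvector for `λ < -K` satisfies the eigenvalue equation of `A` up to `η (|λ| +
1)`, while its distance to the spectrum of `A` is at least `-K - λ`. With `η ≤ 1 / 2` this gives `λ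
≥ -(1 + 2K)`, a bound independent of `A'`. -/
theorem lower_bound_of_relClose (hA : IsSBC A) {η K : ℝ} {M : H ≃ₗᵢ[ℂ] H}
    (hη : η ≤ 1 / 2) (hK : 0 ≤ K) (hb : ∀ i, -K ≤ b.val i) (h : RelClose η A' A M) (j : ι') :
    -(1 + 2 * K) ≤ b'.val j := by
  by_cases hj : -K ≤ b'.val j
  · linarith
  obtain ⟨hf, e⟩ := h ⟨b'.basis j, b'.mem j⟩
  rw [b'.apply_basis, map_smul, norm_smul, b'.basis.orthonormal.1, Complex.norm_real,
    Real.norm_eq_abs] at e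
  have h1 := b.le_norm_apply_sub hA ⟨M (b'.basis j), hf⟩ (g := -K - b'.val j) (μ := b'.val j)
    (by linarith) fun i _ => by
      have := hb i
      have := le_abs_self (b.val i - b'.val j)
      linarith
  simp only [M.norm_map, b'.basis.orthonormal.1, mul_one] at h1 e
  have h2 : |b'.val j| = -b'.val j := abs_of_neg (by linarith)
  rw [h2] at e
  nlinarith

/-- Comparison of the eigenvalue counting functions of two relatively close operators. -/
theorem ncard_le_ncard (hA : IsSBC A) (hA' : IsSBC A') {η L μ μ' : ℝ} {M : H ≃ₗᵢ[ℂ] H}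
    (h : RelClose η A A' M) (hη : 0 ≤ η) (hL : 0 ≤ L) (hb : ∀ i, b.val i ≤ μ → |b.val i| ≤ L)
    (hμ : μ + η * (L + 1) < μ') :
    {i | b.val i ≤ μ}.ncard ≤ {j | b'.val j ≤ μ'}.ncard := by
  by_contra! hlt
  set S := {i | b.val i ≤ μ}
  set S' := {j | b'.val j ≤ μ'}
  have := (b'.finite μ').fintype
  have : Fintype S' := this
  have hS : S.Finite := b.finite μ
  set V := Submodule.span ℂ (b.basis '' S) with hV
  have : FiniteDimensional ℂ V := FiniteDimensional.span_of_finite ℂ (hS.image _)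
  -- Min-max by dimension count: `V` has more dimensions than there are conditions, so some nonzero
  -- `f ∈ V` has `M f` orthogonal to all eigenvectors of `A'` with value at most `μ'`. Its form is
  -- then at least `μ' ‖f‖²`, and also at most `(μ + η (L + 1)) ‖f‖²`.
  let φ : V →ₗ[ℂ] (S' → ℂ) := LinearMap.pi fun j =>
    ((innerSL ℂ (b'.basis j) : H →L[ℂ] ℂ) : H →ₗ[ℂ] ℂ) ∘ₗ
      (M.toLinearEquiv : H →ₗ[ℂ] H) ∘ₗ V.subtype
  have hker : LinearMap.ker φ ≠ ⊥ := by
    refine LinearMap.ker_ne_bot_of_finrank_lt ?_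
    rw [Module.finrank_fintype_fun_eq_card, ← Nat.card_eq_fintype_card, Nat.card_coe_set_eq,
      Module.finrank_eq_of_rank_eq (b.rank_span_image hS)]
    exact hlt
  obtain ⟨⟨f, hfV⟩, hfker, hf0⟩ := Submodule.exists_mem_ne_zero_of_ne_bot hker
  have hf0 : f ≠ 0 := fun h => hf0 (Subtype.ext h)
  have hdom : f ∈ A.domain := by
    refine (Submodule.span_le.2 ?_ : V ≤ A.domain) hfV
    rintro _ ⟨i, -, rfl⟩
    exact b.mem i
  have hS1 : ∀ i, inner ℂ (b.basis i) f ≠ 0 → b.val i ≤ μ := fun i hi => by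
    by_contra hiS
    exact hi (b.inner_eq_zero_of_mem_span hfV hiS)
  have hS2 : ∀ j, inner ℂ (b'.basis j) (M f) ≠ 0 → μ' ≤ b'.val j := fun j hj => by
    by_contra! hlt
    exact hj (congrFun (LinearMap.mem_ker.1 hfker) ⟨j, hlt.le⟩)
  obtain ⟨hMf, e⟩ := h ⟨f, hdom⟩
  have h1 := b.form_le hA ⟨f, hdom⟩ hS1
  have h2 := b.norm_apply_le hA ⟨f, hdom⟩ hL fun i hi => hb i (hS1 i hi)
  have h3 := b'.le_form hA' ⟨M f, hMf⟩ hS2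
  have h4 : (inner ℂ (M f) (A' ⟨M f, hMf⟩)).re ≤
      (inner ℂ f (A ⟨f, hdom⟩)).re + ‖f‖ * ‖A' ⟨M f, hMf⟩ - M (A ⟨f, hdom⟩)‖ := by
    have : A' ⟨M f, hMf⟩ = M (A ⟨f, hdom⟩) + (A' ⟨M f, hMf⟩ - M (A ⟨f, hdom⟩)) := by abel
    conv_lhs => rw [this]
    rw [inner_add_right, M.inner_map_map, Complex.add_re]
    gcongr
    refine (Complex.re_le_norm _).trans ((norm_inner_le_norm _ _).trans ?_)
    rw [M.norm_map]
  simp only [M.norm_map] at h1 h2 h3 e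
  have hpos : 0 < ‖f‖ := norm_pos_iff.2 hf0
  have h5 : ‖A' ⟨M f, hMf⟩ - M (A ⟨f, hdom⟩)‖ ≤ η * (L + 1) * ‖f‖ := by
    refine e.trans ?_
    rw [mul_assoc]
    exact mul_le_mul_of_nonneg_left (by linarith) hη
  have h6 : μ' * ‖f‖ ^ 2 ≤ (μ + η * (L + 1)) * ‖f‖ ^ 2 := by
    nlinarith
  exact absurd (le_of_mul_le_mul_right h6 (by positivity)) (not_le.2 hμ)

/-- Two consecutive values of the counting function locate a simple eigenvalue. -/
theorem eigenvalue_mem_of_ncard (hA : IsSBC A) {n : ℕ} {α β : ℝ} (hαβ : α < β)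
    (hα : {i | b.val i ≤ α}.ncard + 1 = n) (hβ : {i | b.val i ≤ β}.ncard = n) :
    IsSimpleEigenvalue A (eigenvalue A n) ∧ α < eigenvalue A n ∧ eigenvalue A n ≤ β := by
  have hsub : {i | b.val i ≤ α} ⊆ {i | b.val i ≤ β} := fun i hi => le_trans hi hαβ.le
  have hdiff : ({i | b.val i ≤ β} \ {i | b.val i ≤ α}).ncard = 1 := by
    have := Set.ncard_sdiff_add_ncard_of_subset hsub (b.finite β)
    omega
  obtain ⟨j, hj⟩ := Set.ncard_eq_one.1 hdiff
  have hj' : ∀ i, b.val i ≤ β → α < b.val i → i = j := fun i h1 h2 => by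
    have : i ∈ ({j} : Set ι) := hj ▸ ⟨h1, not_le.2 h2⟩
    exact this
  have hjm : j ∈ {i | b.val i ≤ β} \ {i | b.val i ≤ α} := hj ▸ rfl
  have hj1 : b.val j ≤ β := hjm.1
  have hj2 : α < b.val j := not_le.1 hjm.2
  have hleast : IsLeast {μ : ℝ | n ≤ {i | b.val i ≤ μ}.ncard} (b.val j) := by
    constructor
    · rw [Set.mem_ofPred_eq, ← hβ]
      refine Set.ncard_le_ncard (fun i hi => ?_) (b.finite _)
      by_cases hi' : b.val i ≤ α
      · exact hi'.trans hj2.le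
      · rw [hj' i hi (not_le.1 hi')]
        exact le_refl (b.val j)
    · intro μ hμ
      by_contra! hlt
      have hμ : n ≤ {i | b.val i ≤ μ}.ncard := hμ
      have : {i | b.val i ≤ μ}.ncard ≤ {i | b.val i ≤ α}.ncard := by
        refine Set.ncard_le_ncard (fun i hi => ?_) (b.finite _)
        have hi : b.val i ≤ μ := hi
        by_contra hi'
        have := hj' i (by linarith) (not_le.1 hi')
        rw [this] at hi
        linarith
      omega
  have heq : eigenvalue A n = b.val j := by rw [b.eigenvalue_eq_sInf hA, hleast.csInf_eq]
  rw [heq]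
  refine ⟨?_, hj2, hj1⟩
  unfold IsSimpleEigenvalue
  rw [b.finrank_eigenspace hA, Set.ncard_eq_one]
  refine ⟨j, Set.eq_singleton_iff_unique_mem.2 ⟨rfl, fun i hi => ?_⟩⟩
  have hi : b.val i = b.val j := hi
  exact hj' i (hi ▸ hj1) (hi ▸ hj2)

/-- A simple eigenvalue is isolated, and it determines the counting function in a
neighbourhood. -/
theorem exists_gap (hA : IsSBC A) (hinf : ¬ FiniteDimensional ℂ H) {n : ℕ} (hn : 1 ≤ n)
    (hs : IsSimpleEigenvalue A (eigenvalue A n)) :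
    ∃ g > 0, (∀ i, b.val i ≠ eigenvalue A n → g < |b.val i - eigenvalue A n|) ∧
      ∀ ρ, 0 < ρ → ρ ≤ g → {i | b.val i ≤ eigenvalue A n - ρ}.ncard + 1 = n ∧
        {i | b.val i ≤ eigenvalue A n + ρ}.ncard = n := by
  have : Infinite ι := b.infinite_index hinf
  set l := eigenvalue A n with hl
  have hl' := b.eigenvalue_eq_sInf hA n
  rw [← hl] at hl'
  -- the gap
  have hgap : ∃ g > 0, ∀ i, b.val i ≠ l → g < |b.val i - l| := by
    have hfin : (b.val '' {i | b.val i ≤ l + 1} \ {l}).Finite :=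
      ((b.finite (l + 1)).image _).sdiff
    have hopen : (b.val '' {i | b.val i ≤ l + 1} \ {l})ᶜ ∈ 𝓝 l :=
      hfin.isClosed.isOpen_compl.mem_nhds (fun h => h.2 rfl)
    obtain ⟨r, hr, hball⟩ := Metric.mem_nhds_iff.1 hopen
    -- The bound `1 / 2` keeps a closer eigenvalue among the finitely many below `l + 1`; the bound
    -- `r / 2` puts it in the ball free of them.
    refine ⟨min (r / 2) (1 / 2), by positivity, fun i hi => ?_⟩
    by_contra! hle
    have h1 : |b.val i - l| ≤ r / 2 := hle.trans (min_le_left _ _)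
    have h2 : |b.val i - l| ≤ 1 / 2 := hle.trans (min_le_right _ _)
    refine hball (show b.val i ∈ _ from ?_) ⟨⟨i, ?_, rfl⟩, hi⟩
    · rw [Metric.mem_ball, Real.dist_eq]
      linarith
    · have := (abs_le.1 h2).2
      show b.val i ≤ l + 1
      linarith
  obtain ⟨g, hg, hgap⟩ := hgap
  -- the counting function
  have hne : {μ : ℝ | n ≤ {i | b.val i ≤ μ}.ncard}.Nonempty := by
    -- Infinite dimension provides `n` eigenvalues; without them the set could be empty and its
    -- `sInf` the default value `0`.
    obtain ⟨s, hs⟩ := Infinite.exists_subset_card_eq ι n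
    obtain ⟨μ, hμ⟩ := (s.finite_toSet.image b.val).bddAbove
    refine ⟨μ, ?_⟩
    rw [Set.mem_ofPred_eq, ← hs, ← Set.ncard_coe_finset]
    exact Set.ncard_le_ncard (fun i hi => hμ ⟨i, hi, rfl⟩) (b.finite μ)
  have hbdd : BddBelow {μ : ℝ | n ≤ {i | b.val i ≤ μ}.ncard} := by
    obtain ⟨K, -, hK⟩ := b.exists_lower_bound
    refine ⟨-K, fun μ hμ => ?_⟩
    have hμ : n ≤ {i | b.val i ≤ μ}.ncard := hμ
    have : {i | b.val i ≤ μ}.Nonempty := by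
      rw [← Set.ncard_pos (b.finite μ)]
      omega
    obtain ⟨i, hi⟩ := this
    exact (hK i).trans hi
  have hlow : ∀ μ < l, {i | b.val i ≤ μ}.ncard < n := fun μ hμ => by
    by_contra! h
    exact absurd (csInf_le hbdd h) (not_le.2 (hl' ▸ hμ))
  have hup : ∀ μ, l < μ → n ≤ {i | b.val i ≤ μ}.ncard := fun μ hμ => by
    obtain ⟨ν, hν, hlt⟩ := exists_lt_of_csInf_lt hne (hl' ▸ hμ)
    exact le_trans hν (Set.ncard_le_ncard (fun i (hi : b.val i ≤ ν) => hi.trans hlt.le)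
      (b.finite μ))
  have hone : {i | b.val i = l}.ncard = 1 := by
    rw [← b.finrank_eigenspace hA]
    exact hs
  refine ⟨g, hg, hgap, fun ρ h0 hρ => ?_⟩
  have hunion : {i | b.val i ≤ l + ρ} = {i | b.val i ≤ l - ρ} ∪ {i | b.val i = l} := by
    ext i
    simp only [Set.mem_ofPred_eq, Set.mem_union]
    constructor
    · intro hi
      by_cases h : b.val i = l
      · exact Or.inr h
      · left
        rcases lt_abs.1 (hgap i h) with h1 | h1 <;> linarith
    · rintro (h | h) <;> linarith
  have hcard := Set.ncard_union_eq (s := {i | b.val i ≤ l - ρ}) (t := {i | b.val i = l})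
    (Set.disjoint_left.2 fun i (h1 : b.val i ≤ l - ρ) (h2 : b.val i = l) => by linarith)
    (b.finite _) ((b.finite l).subset fun i hi => le_of_eq hi)
  rw [← hunion, hone] at hcard
  have h1 := hlow (l - ρ) (by linarith)
  have h2 := hup (l + ρ) (by linarith)
  omega

end Eigenbasis

/-- A simple eigenvalue persists under relatively small perturbations. -/
theorem exists_eigenvalue_close [CompleteSpace H] {A : H →ₗ.[ℂ] H} (hA : IsSBC A) (hinf : ¬ FiniteDimensional ℂ H) {n : ℕ}
    (hn : 1 ≤ n) (hs : IsSimpleEigenvalue A (eigenvalue A n)) {ρ : ℝ} (hρ : 0 < ρ) :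
    ∃ η > 0, ∀ (A' : H →ₗ.[ℂ] H) (M : H ≃ₗᵢ[ℂ] H), IsSBC A' → RelClose η A A' M →
      RelClose η A' A M.symm → IsSimpleEigenvalue A' (eigenvalue A' n) ∧
        |eigenvalue A' n - eigenvalue A n| ≤ ρ := by
  obtain ⟨ι, ⟨b⟩⟩ := hA.exists_eigenbasis
  obtain ⟨g, hg, -, hcount⟩ := b.exists_gap hA hinf hn hs
  obtain ⟨K, hK, hKb⟩ := b.exists_lower_bound
  set l := eigenvalue A n
  -- With `2r ≤ g` the counting function of `A` is known at `l ± r / 4` and at `l ± 2r`.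
  set r := min ρ (g / 2)
  have hr : 0 < r := by positivity
  have hrρ : r ≤ ρ := min_le_left _ _
  have hrg : 2 * r ≤ g := by linarith [min_le_right ρ (g / 2)]
  -- `L` bounds the absolute value of every eigenvalue up to `l + g`, for `A` and for each
  -- admissible `A'` alike, so `η` can be chosen before `A'`.
  set L := 1 + 2 * K + |l| + g with hLdef
  have hL : 0 ≤ L := by positivity
  have hl1 := le_abs_self l
  have hl2 := neg_abs_le l
  set η := min (1 / 2) (r / (2 * (L + 1)))
  have hη : 0 < η := by positivity
  have hηL : η * (L + 1) ≤ r / 2 := by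
    calc η * (L + 1) ≤ r / (2 * (L + 1)) * (L + 1) := by gcongr; exact min_le_right _ _
      _ = r / 2 := by field_simp
  refine ⟨η, hη, fun A' M hA' h1 h2 => ?_⟩
  obtain ⟨ι', ⟨b'⟩⟩ := hA'.exists_eigenbasis
  have hKb' := b.lower_bound_of_relClose b' hA (min_le_left _ _) hK hKb h2
  have hbound : ∀ μ ≤ l + g, ∀ i, b.val i ≤ μ → |b.val i| ≤ L := fun μ hμ i hi =>
    abs_le.2 ⟨by linarith [hKb i, abs_nonneg l], by linarith⟩
  have hbound' : ∀ μ ≤ l + g, ∀ i, b'.val i ≤ μ → |b'.val i| ≤ L := fun μ hμ i hi =>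
    abs_le.2 ⟨by linarith [hKb' i, abs_nonneg l], by linarith⟩
  -- A comparison costs a shift of at most `r / 2`. The count of `A'` at `l - r` lies between those
  -- of `A` at `l - 2r` and `l - r / 4`, both `n - 1`; at `l + r` it lies between those at `l + r /
  -- 4` and `l + 2r`, both `n`.
  have c1 := b'.ncard_le_ncard b hA' hA h2 hη.le hL (hbound' (l - r) (by linarith))
    (μ' := l - r / 4) (by linarith)
  have c2 := b.ncard_le_ncard b' hA hA' h1 hη.le hL (hbound (l - 2 * r) (by linarith))
    (μ' := l - r) (by linarith)
  have c3 := b'.ncard_le_ncard b hA' hA h2 hη.le hL (hbound' (l + r) (by linarith))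
    (μ' := l + 2 * r) (by linarith)
  have c4 := b.ncard_le_ncard b' hA hA' h1 hη.le hL (hbound (l + r / 4) (by linarith))
    (μ' := l + r) (by linarith)
  have d1 := hcount (r / 4) (by linarith) (by linarith)
  have d2 := hcount (2 * r) (by linarith) hrg
  obtain ⟨e1, e2, e3⟩ := b'.eigenvalue_mem_of_ncard hA' (n := n) (α := l - r) (β := l + r)
    (by linarith) (by omega) (by omega)
  exact ⟨e1, abs_le.2 ⟨by linarith, by linarith⟩⟩

theorem IsSimpleEigenvalue.eigenspace_eq_span {A : H →ₗ.[ℂ] H} {μ : ℝ}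
    (hs : IsSimpleEigenvalue A μ) {ψ : H} (hψ : IsNormalizedEigenfunction A μ ψ) :
    eigenspace A μ = Submodule.span ℂ {ψ} := by
  have hne : ψ ≠ 0 := by
    rintro rfl
    simpa using hψ.2
  have hfd : FiniteDimensional ℂ (eigenspace A μ) :=
    FiniteDimensional.of_finrank_pos (by rw [hs]; exact one_pos)
  refine (Submodule.eq_of_le_of_finrank_eq ?_ ?_).symm
  · rw [Submodule.span_singleton_le_iff_mem]
    exact hψ.1
  · rw [finrank_span_singleton hne]
    exact hs.symm

/-- Simplicity of an eigenvalue and the direction of its eigenvector are stable under relatively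
small perturbations. -/
theorem exists_eigenfunction_close [CompleteSpace H] {A : H →ₗ.[ℂ] H} (hA : IsSBC A)
    (hinf : ¬ FiniteDimensional ℂ H) {n : ℕ} (hn : 1 ≤ n)
    (hs : IsSimpleEigenvalue A (eigenvalue A n)) {ψ₀ : H}
    (hψ₀ : IsNormalizedEigenfunction A (eigenvalue A n) ψ₀) {ρ : ℝ} (hρ : 0 < ρ) :
    ∃ η > 0, ∀ (A' : H →ₗ.[ℂ] H) (M : H ≃ₗᵢ[ℂ] H), IsSBC A' → RelClose η A A' M →
      RelClose η A' A M.symm → IsSimpleEigenvalue A' (eigenvalue A' n) ∧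
        ∀ ψ, IsNormalizedEigenfunction A' (eigenvalue A' n) ψ →
          ‖M.symm ψ - inner ℂ ψ₀ (M.symm ψ) • ψ₀‖ ≤ ρ := by
  obtain ⟨ι, ⟨b⟩⟩ := hA.exists_eigenbasis
  obtain ⟨g, hg, hgap, -⟩ := b.exists_gap hA hinf hn hs
  set l := eigenvalue A n
  -- The residual `‖(A - l) f‖` gets `ρ g / 2` from the shift of the eigenvalue and `ρ g / 2` from
  -- the relative error; the bound `1` gives `|ν| ≤ |l| + 1`.
  set r := min 1 (ρ * g / 2)
  have hr : 0 < r := by positivity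
  obtain ⟨η₁, hη₁, hclose⟩ := exists_eigenvalue_close hA hinf hn hs hr
  set η := min η₁ (ρ * g / (2 * (|l| + 2)))
  have hη : 0 < η := by positivity
  have hηl : η * (|l| + 2) ≤ ρ * g / 2 := by
    calc η * (|l| + 2) ≤ ρ * g / (2 * (|l| + 2)) * (|l| + 2) := by
          gcongr; exact min_le_right _ _
      _ = ρ * g / 2 := by field_simp
  refine ⟨η, hη, fun A' M hA' h1 h2 => ?_⟩
  obtain ⟨hs', hclose⟩ := hclose A' M hA' (h1.mono (min_le_left _ _)) (h2.mono (min_le_left _ _))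
  refine ⟨hs', fun ψ hψ => ?_⟩
  set ν := eigenvalue A' n
  obtain ⟨⟨hψd, eψ⟩, hψn⟩ := hψ
  obtain ⟨hfd, e⟩ := h2 ⟨ψ, hψd⟩
  simp only [eψ, map_smul, norm_smul, hψn, Complex.norm_real, Real.norm_eq_abs, mul_one] at e
  set f := M.symm ψ with hf
  have hfn : ‖f‖ = 1 := by rw [hf, M.symm.norm_map, hψn]
  obtain ⟨⟨hψ₀d, eψ₀⟩, hψ₀n⟩ := id hψ₀
  set c := inner ℂ ψ₀ f with hc
  -- Removing the component along `ψ₀` does not change the residual `(A - l) f`, and on what remains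
  -- `A - l` is bounded below by the gap `g`.
  let h : A.domain := ⟨f, hfd⟩ - c • ⟨ψ₀, hψ₀d⟩
  have hAh : A h - (l : ℂ) • (h : H) = A ⟨f, hfd⟩ - (l : ℂ) • f := by
    have hh : (h : H) = f - c • ψ₀ := rfl
    rw [hh]
    simp only [h, LinearPMap.map_sub, LinearPMap.map_smul, eψ₀, smul_sub]
    rw [smul_comm]
    abel
  have horth : inner ℂ ψ₀ (h : H) = 0 := by
    show inner ℂ ψ₀ (f - c • ψ₀) = 0
    rw [inner_sub_right, inner_smul_right, inner_self_eq_norm_sq_to_K, hψ₀n, ← hc]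
    simp
  have hlow := b.le_norm_apply_sub hA h hg.le (μ := l) fun i hi => by
    refine (hgap i fun hil => hi ?_).le
    have hmem : b.basis i ∈ eigenspace A l := hil ▸ b.basis_mem_eigenspace i
    rw [hs.eigenspace_eq_span hψ₀, Submodule.mem_span_singleton] at hmem
    obtain ⟨z, hz⟩ := hmem
    rw [← hz, inner_smul_left, horth, mul_zero]
  rw [hAh] at hlow
  have hup : ‖A ⟨f, hfd⟩ - (l : ℂ) • f‖ ≤ ρ * g := by
    have h3 : A ⟨f, hfd⟩ - (l : ℂ) • f =
        (A ⟨f, hfd⟩ - (ν : ℂ) • f) + ((ν - l : ℝ) : ℂ) • f := by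
      push_cast
      rw [sub_smul]
      abel
    rw [h3]
    refine (norm_add_le _ _).trans ?_
    rw [norm_smul, hfn, Complex.norm_real, Real.norm_eq_abs, mul_one]
    have h4 : |ν| ≤ |l| + 1 := by
      have := abs_sub_abs_le_abs_sub ν l
      have := min_le_left 1 (ρ * g / 2)
      linarith
    have h5 := min_le_right 1 (ρ * g / 2)
    have h6 : η * (|ν| + 1) ≤ η * (|l| + 2) := mul_le_mul_of_nonneg_left (by linarith) hη.le
    linarith
  have : g * ‖f - c • ψ₀‖ ≤ g * ρ := by
    rw [mul_comm g ρ]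
    exact hlow.trans hup
  exact le_of_mul_le_mul_left this hg

end Perturbation

/-! ### The Leibniz rule for products with `e^{i⟨t, x⟩}`. -/

section Leibniz

variable {d : ℕ}

theorem norm_expi (t x : Space d) : ‖expi t x‖ = 1 := by
  rw [expi, mul_comm]
  exact Complex.norm_exp_ofReal_mul_I _

theorem expi_zero (x : Space d) : expi 0 x = 1 := by simp [expi]

theorem expi_add (t t' x : Space d) : expi (t + t') x = expi t x * expi t' x := by
  simp only [expi, ← Complex.exp_add, inner_add_left]
  push_cast
  ring_nf

theorem expi_add_right (t x y : Space d) : expi t (x + y) = expi t x * expi t y := by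
  simp only [expi, ← Complex.exp_add, inner_add_right]
  push_cast
  ring_nf

theorem contDiff_expi (t : Space d) : ContDiff ℝ (⊤ : ℕ∞) (expi t) := by
  unfold expi
  exact (contDiff_const.mul (Complex.ofRealCLM.contDiff.comp
    (contDiff_const.inner ℝ contDiff_id))).cexp

theorem hasFDerivAt_expi (t x : Space d) :
    HasFDerivAt (expi t)
      (expi t x • (Complex.I • (Complex.ofRealCLM.comp (innerSL ℝ t)))) x := by
  have h : HasFDerivAt (fun y : Space d => Complex.I * ((inner ℝ t y : ℝ) : ℂ))
      (Complex.I • (Complex.ofRealCLM.comp (innerSL ℝ t))) x :=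
    ((Complex.ofRealCLM.comp (innerSL ℝ t)).hasFDerivAt (x := x)).const_mul Complex.I
  exact h.cexp

theorem partialD_expi_mul (k : Fin d) (t : Space d) {φ : Space d → ℂ} (hφ : Differentiable ℝ φ) :
    partialD k (fun x => expi t x * φ x) =
      fun x => expi t x * (partialD k φ x + (t k : ℂ) * φ x) := by
  funext x
  have h := (hasFDerivAt_expi t x).mul (hφ x).hasFDerivAt
  simp only [partialD]
  erw [h.fderiv]
  have hin : inner ℝ t (EuclideanSpace.single k (1 : ℝ)) = t k := by
    simp [EuclideanSpace.inner_single_right]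
  simp only [add_apply, smul_apply, ContinuousLinearMap.comp_apply, innerSL_apply_apply, hin,
    Complex.ofRealCLM_apply, smul_eq_mul]
  field_simp

/-- The smooth complex functions on `ℝᵈ`. -/
def smoothFun (d : ℕ) : Submodule ℂ (Space d → ℂ) where
  carrier := {φ | ContDiff ℝ (⊤ : ℕ∞) φ}
  zero_mem' := show ContDiff ℝ (⊤ : ℕ∞) (fun _ => (0 : ℂ)) from contDiff_const
  add_mem' {φ ψ} (h : ContDiff ℝ (⊤ : ℕ∞) φ) (h' : ContDiff ℝ (⊤ : ℕ∞) ψ) :=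
    show ContDiff ℝ (⊤ : ℕ∞) (φ + ψ) from h.add h'
  smul_mem' c φ (h : ContDiff ℝ (⊤ : ℕ∞) φ) :=
    show ContDiff ℝ (⊤ : ℕ∞) (c • φ) from contDiff_const.smul h

theorem smoothFun.contDiff (φ : smoothFun d) : ContDiff ℝ (⊤ : ℕ∞) (φ : Space d → ℂ) := φ.2

theorem smoothFun.differentiable (φ : smoothFun d) : Differentiable ℝ (φ : Space d → ℂ) :=
  (smoothFun.contDiff φ).differentiable (by simp)

/-- `D_k` as an endomorphism of the smooth functions. -/
def partialEnd (k : Fin d) : Module.End ℂ (smoothFun d) where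
  toFun φ := ⟨partialD k φ, show ContDiff ℝ (⊤ : ℕ∞) (partialD k φ) from contDiff_const.mul
    (((smoothFun.contDiff φ).fderiv_right (m := (⊤ : ℕ∞)) (by simp)).clm_apply contDiff_const)⟩
  map_add' φ ψ := Subtype.ext <| funext fun x => by
    have hφ : DifferentiableAt ℝ (φ : Space d → ℂ) x := smoothFun.differentiable φ x
    have hψ : DifferentiableAt ℝ (ψ : Space d → ℂ) x := smoothFun.differentiable ψ x
    simp [partialD, fderiv_add hφ hψ, mul_add]
  map_smul' c φ := Subtype.ext <| funext fun x => by
    have hφ : DifferentiableAt ℝ (φ : Space d → ℂ) x := smoothFun.differentiable φ x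
    simp [partialD, fderiv_const_smul hφ c, mul_left_comm]

/-- Multiplication by `e^{i⟨t, x⟩}` as an endomorphism of the smooth functions. -/
def expiEnd (t : Space d) : Module.End ℂ (smoothFun d) where
  toFun φ := ⟨fun x => expi t x * φ.1 x, show ContDiff ℝ (⊤ : ℕ∞) (fun x => expi t x * φ.1 x) from
    (contDiff_expi t).mul (smoothFun.contDiff φ)⟩
  map_add' φ ψ := Subtype.ext <| funext fun x => by simp [mul_add]
  map_smul' c φ := Subtype.ext <| funext fun x => by simp [mul_left_comm]

/-- `D_α` as an endomorphism of the smooth functions. -/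
def mixedEnd (α : Fin d → ℕ) : Module.End ℂ (smoothFun d) :=
  ((List.finRange d).map fun k => partialEnd k ^ α k).prod

theorem coe_partialEnd_pow (k : Fin d) (n : ℕ) (φ : smoothFun d) :
    (((partialEnd k ^ n) φ : smoothFun d) : Space d → ℂ) = (partialD k)^[n] φ := by
  induction n generalizing φ with
  | zero => rfl
  | succ n ih =>
    rw [pow_succ, Module.End.mul_apply, ih, Function.iterate_succ_apply]
    rfl

theorem coe_mixedEnd (α : Fin d → ℕ) (φ : smoothFun d) :
    ((mixedEnd α φ : smoothFun d) : Space d → ℂ) = mixedD α φ := by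
  unfold mixedEnd mixedD
  induction List.finRange d with
  | nil => rfl
  | cons k l ih =>
    rw [List.map_cons, List.prod_cons, Module.End.mul_apply, coe_partialEnd_pow, ih]
    rfl

/-- Conjugation by the character shifts `D_k` by a scalar. As a `SemiconjBy` statement it passes to
powers and ordered products, hence to `D_α`, with no further calculus. -/
theorem semiconjBy_expiEnd (k : Fin d) (t : Space d) :
    SemiconjBy (expiEnd t) (partialEnd k) (partialEnd k + (-(t k : ℂ)) • 1) := by
  refine LinearMap.ext fun φ => Subtype.ext ?_
  have h := partialD_expi_mul k t (smoothFun.differentiable φ)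
  funext x
  have hx := congrFun h x
  show expi t x * partialD k φ x = partialD k (fun x => expi t x * φ.1 x) x +
    -(t k : ℂ) * (expi t x * φ.1 x)
  rw [hx]
  ring

theorem SemiconjBy.list_prod_map {R ι : Type*} [Monoid R] {e : R} {x y : ι → R} (l : List ι)
    (h : ∀ i, SemiconjBy e (x i) (y i)) : SemiconjBy e (l.map x).prod (l.map y).prod := by
  induction l with
  | nil => exact SemiconjBy.one_right e
  | cons k l ih =>
    rw [List.map_cons, List.map_cons, List.prod_cons, List.prod_cons]
    exact (h k).mul_right ih

/-- Distributivity for ordered products: the endomorphism ring in which it is used is not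
commutative. -/
theorem list_prod_map_finRange_sum {R : Type*} [Semiring R] {d : ℕ} (s : Fin d → Finset ℕ)
    (f : Fin d → ℕ → R) :
    ((List.finRange d).map fun k => ∑ j ∈ s k, f k j).prod =
      ∑ β ∈ Fintype.piFinset s, ((List.finRange d).map fun k => f k (β k)).prod := by
  induction d with
  | zero => simp
  | succ d ih =>
    simp only [List.finRange_succ, List.map_cons, List.prod_cons, List.map_map, Function.comp_def]
    rw [ih (fun k => s k.succ) (fun k => f k.succ), Finset.sum_mul_sum, ← Finset.sum_product']
    refine Finset.sum_nbij' (fun p => (Fin.cons p.1 p.2 : Fin (d + 1) → ℕ))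
      (fun β => (β 0, Fin.tail β)) ?_ ?_ ?_ ?_ ?_
    · rintro ⟨j, β⟩ h
      simp only [Finset.mem_product, Fintype.mem_piFinset] at h ⊢
      exact Fin.cases h.1 h.2
    · intro β h
      simp only [Finset.mem_product, Fintype.mem_piFinset] at h ⊢
      exact ⟨h 0, fun k => h k.succ⟩
    · rintro ⟨j, β⟩ _
      simp
    · intro β _
      exact Fin.cons_self_tail β
    · rintro ⟨j, β⟩ _
      simp

theorem list_prod_map_smul {R ι : Type*} [Semiring R] [Algebra ℂ R] (l : List ι) (c : ι → ℂ)
    (y : ι → R) : (l.map fun k => c k • y k).prod = (l.map c).prod • (l.map y).prod := by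
  induction l with
  | nil => simp
  | cons k l ih => simp only [List.map_cons, List.prod_cons, ih, smul_mul_smul_comm]

/-- The multi-indices `β ≤ α`. -/
def subIndices (α : Fin d → ℕ) : Finset (Fin d → ℕ) :=
  Fintype.piFinset fun k => Finset.range (α k + 1)

theorem mem_subIndices {α β : Fin d → ℕ} : β ∈ subIndices α ↔ ∀ k, β k ≤ α k := by
  simp [subIndices]

/-- The coefficient of `D_β` in the expansion of `(D + t)_α`. -/
def leibnizCoeff (t : Space d) (α β : Fin d → ℕ) : ℂ :=
  ∏ k, (((α k).choose (β k) : ℂ) * (t k : ℂ) ^ (α k - β k))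

/-- The binomial theorem in each factor, where `D_k` commutes with a scalar; commutation of
different `D_k` is not needed. -/
theorem prod_partialEnd_add_pow (t : Space d) (α : Fin d → ℕ) :
    ((List.finRange d).map fun k =>
        (partialEnd k + (t k : ℂ) • (1 : Module.End ℂ (smoothFun d))) ^ α k).prod =
      ∑ β ∈ subIndices α, leibnizCoeff t α β • mixedEnd β := by
  have h : ∀ k : Fin d, (partialEnd k + (t k : ℂ) • (1 : Module.End ℂ (smoothFun d))) ^ α k =
      ∑ j ∈ Finset.range (α k + 1),
        (((α k).choose j : ℂ) * (t k : ℂ) ^ (α k - j)) • partialEnd k ^ j := by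
    intro k
    rw [((Commute.one_right (partialEnd k)).smul_right (t k : ℂ)).add_pow]
    refine Finset.sum_congr rfl fun j _ => ?_
    rw [smul_pow, one_pow, mul_smul_comm, mul_one, smul_mul_assoc, ← Nat.cast_comm,
      ← nsmul_eq_mul, ← Nat.cast_smul_eq_nsmul ℂ, smul_smul, mul_comm]
  simp only [h]
  rw [list_prod_map_finRange_sum (fun k => Finset.range (α k + 1))
    (fun k j => (((α k).choose j : ℂ) * (t k : ℂ) ^ (α k - j)) • partialEnd k ^ j)]
  refine Finset.sum_congr rfl fun β _ => ?_
  rw [list_prod_map_smul, leibnizCoeff, Fin.prod_univ_def]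
  rfl

/-- The right side differentiates the product `e^{i⟨t, y⟩} φ(y)`, because this product serves as the
new test function in the weak Leibniz rule. -/
theorem expi_mul_mixedD (t : Space d) (α : Fin d → ℕ) {φ : Space d → ℂ}
    (hφ : ContDiff ℝ (⊤ : ℕ∞) φ) (x : Space d) :
    expi t x * mixedD α φ x =
      ∑ β ∈ subIndices α, leibnizCoeff (-t) α β * mixedD β (fun y => expi t y * φ y) x := by
  have h := SemiconjBy.list_prod_map (List.finRange d)
    fun k => (semiconjBy_expiEnd k t).pow_right (α k)
  have h2 := prod_partialEnd_add_pow (-t) α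
  simp only [PiLp.neg_apply, Complex.ofReal_neg] at h2
  rw [h2] at h
  have h3 := congrFun (congrArg Subtype.val
    (LinearMap.congr_fun h.eq (⟨φ, hφ⟩ : smoothFun d))) x
  have h4 := congrFun (coe_mixedEnd α ⟨φ, hφ⟩) x
  have h5 : ∀ β, (mixedEnd β (expiEnd t ⟨φ, hφ⟩)).1 x = mixedD β (fun y => expi t y * φ y) x :=
    fun β => congrFun (coe_mixedEnd β (expiEnd t ⟨φ, hφ⟩)) x
  simp only [← h4, ← h5]
  refine Eq.trans h3 ?_
  simp [Module.End.mul_apply, LinearMap.sum_apply]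

/-- The parity of `|α| - |β|` absorbs the sign of `t`. This reconciles the signs of the integrations
by parts of orders `|α|` and `|β|`. -/
theorem leibnizCoeff_neg (t : Space d) {α β : Fin d → ℕ} (h : β ∈ subIndices α) :
    (-1 : ℂ) ^ (∑ i, α i) * leibnizCoeff (-t) α β = (-1) ^ (∑ i, β i) * leibnizCoeff t α β := by
  rw [mem_subIndices] at h
  simp only [leibnizCoeff, ← Finset.prod_pow_eq_pow_sum, ← Finset.prod_mul_distrib]
  refine Finset.prod_congr rfl fun k _ => ?_
  obtain ⟨j, hj⟩ := Nat.exists_eq_add_of_le (h k)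
  rw [hj, Nat.add_sub_cancel_left, PiLp.neg_apply, Complex.ofReal_neg, neg_pow (t k : ℂ), pow_add]
  have : ((-1 : ℂ) ^ j) * (-1) ^ j = 1 := by rw [← mul_pow]; simp
  linear_combination ((-1 : ℂ) ^ β k * ((β k + j).choose (β k)) * (t k : ℂ) ^ j) * this

theorem leibnizCoeff_self (t : Space d) (α : Fin d → ℕ) : leibnizCoeff t α α = 1 := by
  simp [leibnizCoeff]

theorem leibnizCoeff_zero {α β : Fin d → ℕ} (h : β ∈ subIndices α) (hne : β ≠ α) :
    leibnizCoeff 0 α β = 0 := by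
  rw [mem_subIndices] at h
  obtain ⟨k, hk⟩ := Function.ne_iff.1 hne
  refine Finset.prod_eq_zero (Finset.mem_univ k) ?_
  have : α k - β k ≠ 0 := by have := h k; omega
  simp [this]

theorem continuous_leibnizCoeff (α β : Fin d → ℕ) :
    Continuous fun t : Space d => leibnizCoeff t α β := by
  unfold leibnizCoeff
  fun_prop

theorem sum_lt_of_mem_subIndices {α β : Fin d → ℕ} (h : β ∈ subIndices α) (hne : β ≠ α) :
    ∑ i, β i < ∑ i, α i := by
  rw [mem_subIndices] at h
  obtain ⟨k, hk⟩ := Function.ne_iff.1 hne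
  exact Finset.sum_lt_sum (fun i _ => h i) ⟨k, Finset.mem_univ k, lt_of_le_of_ne (h k) hk⟩

theorem sum_le_of_mem_subIndices {α β : Fin d → ℕ} (h : β ∈ subIndices α) :
    ∑ i, β i ≤ ∑ i, α i :=
  Finset.sum_le_sum fun i _ => mem_subIndices.1 h i

theorem locallyIntegrable_expi_smul {m : ℕ} (t : Space d) {u : Space d → Vec m}
    (hu : LocallyIntegrable u volume) :
    LocallyIntegrable (fun x => expi t x • u x) volume :=
  hu.mono ((contDiff_expi t).continuous.aestronglyMeasurable.smul hu.aestronglyMeasurable)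
    (Eventually.of_forall fun x => by rw [norm_smul, norm_expi, one_mul])

/-- The Leibniz rule for the weak derivatives of `e^{i⟨t, x⟩} u`. -/
theorem HasWeakD.expi_smul {m : ℕ} (t : Space d) {α : Fin d → ℕ} {u : Space d → Vec m}
    {w : (Fin d → ℕ) → Space d → Vec m} (h : ∀ β ∈ subIndices α, HasWeakD β u (w β)) :
    HasWeakD α (fun x => expi t x • u x)
      (fun x => expi t x • ∑ β ∈ subIndices α, leibnizCoeff t α β • w β x) := by
  have hα := h α (mem_subIndices.2 fun k => le_rfl)
  refine ⟨locallyIntegrable_expi_smul t hα.1, locallyIntegrable_expi_smul t ?_, ?_⟩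
  · have := locallyIntegrable_finsetSum' (subIndices α) (μ := volume)
      (f := fun β => leibnizCoeff t α β • w β) fun β hβ => (h β hβ).2.smul _
    refine this.congr (Eventually.of_forall fun x => ?_)
    simp
  · intro φ hφ hc
    -- The exponential moves from `u` to the test function, against which the given weak derivatives
    -- of `u` are then applied.
    have hψ : ContDiff ℝ (⊤ : ℕ∞) (fun y => expi t y * φ y) := (contDiff_expi t).mul hφ
    have hψc : HasCompactSupport (fun y => expi t y * φ y) := hc.mul_left
    have e1 : ∀ x, φ x • expi t x • ∑ β ∈ subIndices α, leibnizCoeff t α β • w β x =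
        ∑ β ∈ subIndices α, leibnizCoeff t α β • ((expi t x * φ x) • w β x) := by
      intro x
      rw [smul_smul, mul_comm, Finset.smul_sum]
      exact Finset.sum_congr rfl fun β _ => smul_comm _ _ _
    have e2 : ∀ x, mixedD α φ x • expi t x • u x = ∑ β ∈ subIndices α,
        leibnizCoeff (-t) α β • (mixedD β (fun y => expi t y * φ y) x • u x) := by
      intro x
      rw [smul_smul, mul_comm, expi_mul_mixedD t α hφ, Finset.sum_smul]
      exact Finset.sum_congr rfl fun β _ => mul_smul _ _ _
    simp only [e1, e2]
    rw [integral_finsetSum, integral_finsetSum, Finset.smul_sum]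
    · refine Finset.sum_congr rfl fun β hβ => ?_
      rw [integral_smul, integral_smul, (h β hβ).3 _ hψ hψc, smul_smul, smul_smul,
        leibnizCoeff_neg t hβ, mul_comm]
    · intro β hβ
      obtain ⟨hD, hDc⟩ := mixedD_smooth β _ hψ hψc
      exact Integrable.smul (leibnizCoeff (-t) α β)
        ((h β hβ).1.integrable_smul_left_of_hasCompactSupport hD.continuous hDc)
    · intro β hβ
      exact Integrable.smul (leibnizCoeff t α β)
        ((h β hβ).2.integrable_smul_left_of_hasCompactSupport hψ.continuous hψc)

end Leibniz

/-! ### The gauge transformation on `L₂ᵐ(F)` and on the graphs of the operators. -/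

section Gauge

variable {d m : ℕ} {F : Set (Space d)}

theorem MemLp.expi_smul (t : Space d) {f : Space d → Vec m} {μ : Measure (Space d)}
    (hf : MemLp f 2 μ) : MemLp (fun x => expi t x • f x) 2 μ :=
  hf.of_le ((contDiff_expi t).continuous.aestronglyMeasurable.smul hf.1)
    (Eventually.of_forall fun x => by rw [norm_smul, norm_expi, one_mul])

/-- Multiplication by `e^{i⟨t, x⟩}` in `L₂ᵐ(F)`, as a function. -/
def expiMulFun (t : Space d) (f : L2 m F) : L2 m F := (MemLp.expi_smul t (Lp.memLp f)).toLp

theorem coeFn_expiMulFun (t : Space d) (f : L2 m F) :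
    expiMulFun t f =ᵐ[volume.restrict F] fun x => expi t x • f x :=
  MemLp.coeFn_toLp _

theorem expiMulFun_neg_cancel (t t' : Space d) (h : t + t' = 0) (f : L2 m F) :
    expiMulFun t (expiMulFun t' f) = f := by
  refine Lp.ext ?_
  filter_upwards [coeFn_expiMulFun t (expiMulFun t' f), coeFn_expiMulFun t' f] with x h1 h2
  rw [h1, h2, smul_smul, ← expi_add, h, expi_zero, one_smul]

/-- Multiplication by `e^{i⟨t, x⟩}` in `L₂ᵐ(F)`. -/
def expiMul (t : Space d) : L2 m F ≃ₗᵢ[ℂ] L2 m F where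
  toFun := expiMulFun t
  invFun := expiMulFun (-t)
  map_add' f g := by
    refine Lp.ext ?_
    filter_upwards [coeFn_expiMulFun t (f + g), coeFn_expiMulFun t f, coeFn_expiMulFun t g,
      Lp.coeFn_add f g, Lp.coeFn_add (expiMulFun t f) (expiMulFun t g)] with x h1 h2 h3 h4 h5
    rw [h1, h5, Pi.add_apply, h2, h3, h4, Pi.add_apply, smul_add]
  map_smul' c f := by
    refine Lp.ext ?_
    rw [RingHom.id_apply]
    filter_upwards [coeFn_expiMulFun t (c • f), coeFn_expiMulFun t f, Lp.coeFn_smul c f,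
      Lp.coeFn_smul c (expiMulFun t f)] with x h1 h2 h3 h4
    rw [h1, h4, Pi.smul_apply, h2, h3, Pi.smul_apply, smul_comm]
  left_inv := expiMulFun_neg_cancel _ _ (neg_add_cancel t)
  right_inv := expiMulFun_neg_cancel _ _ (add_neg_cancel t)
  norm_map' f := by
    show ‖expiMulFun t f‖ = ‖f‖
    rw [Lp.norm_def, Lp.norm_def]
    congr 1
    refine eLpNorm_congr_norm_ae ?_
    filter_upwards [coeFn_expiMulFun t f] with x h
    rw [h, norm_smul, norm_expi, one_mul]

theorem coeFn_expiMul (t : Space d) (f : L2 m F) :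
    expiMul t f =ᵐ[volume.restrict F] fun x => expi t x • f x :=
  coeFn_expiMulFun t f

/-- From `|e^{iy} - 1| ≤ |y|`. Boundedness of `F` makes the convergence to the identity uniform in
`f`, as the commutator with `B` requires. -/
theorem norm_expiMul_sub_le (hF : NullMeasurableSet F volume) {R : ℝ} (hR : ∀ x ∈ F, ‖x‖ ≤ R)
    (t : Space d) (f : L2 m F) : ‖expiMul t f - f‖ ≤ ‖t‖ * R * ‖f‖ := by
  refine Lp.norm_le_mul_norm_of_ae_le_mul ?_
  filter_upwards [coeFn_expiMul t f, Lp.coeFn_sub (expiMul t f) f, ae_restrict_mem₀ hF]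
    with x h1 h2 hx
  rw [h2, Pi.sub_apply, h1]
  have : expi t x • f x - f x = (expi t x - 1) • f x := by rw [sub_smul, one_smul]
  rw [this, norm_smul]
  gcongr
  refine (Real.norm_exp_I_mul_ofReal_sub_one_le).trans ?_
  refine (norm_inner_le_norm t x).trans ?_
  gcongr
  exact hR x hx

/-- The same unimodular factor enters both arguments of the inner product. The phase condition at
`t` thereby becomes the phase condition at `a`. -/
theorem planeWaveCoeff_expiMul (v : Vec m) (t a : Space d) (f : L2 m F) :
    planeWaveCoeff v t (expiMul (t - a) f) = planeWaveCoeff v a f := by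
  unfold planeWaveCoeff
  refine integral_congr_ae ?_
  filter_upwards [coeFn_expiMul (t - a) f] with x h
  rw [h]
  have h1 : expi t x = expi (t - a) x * expi a x := by rw [← expi_add, sub_add_cancel]
  rw [h1, mul_smul, inner_smul_left, inner_smul_right, ← mul_assoc, ← Complex.normSq_eq_conj_mul_self,
    Complex.normSq_eq_norm_sq, norm_expi]
  simp [inner_smul_left, mul_comm]

/-- The plane wave coefficient is the inner product with a vector of `L₂ᵐ(F)`. -/
theorem exists_planeWave (hFb : Bornology.IsBounded F) (v : Vec m) (t : Space d) :
    ∃ p : L2 m F, ∀ ψ, planeWaveCoeff v t ψ = inner ℂ p ψ := by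
  have hfin : IsFiniteMeasure ((volume : Measure (Space d)).restrict F) :=
    ⟨by rw [Measure.restrict_apply_univ]; exact hFb.measure_lt_top⟩
  have hp : MemLp (fun x => expi t x • v) 2 (volume.restrict F) :=
    MemLp.expi_smul t (memLp_const v)
  refine ⟨hp.toLp, fun ψ => ?_⟩
  rw [planeWaveCoeff, L2.inner_def]
  refine integral_congr_ae ?_
  filter_upwards [hp.coeFn_toLp] with x hx
  rw [hx]

theorem IsJet.expi_smul {Ω : Submodule ℤ (Space d)} {N : ℕ} {a : Space d} {f : L2 m F}
    {u : Space d → Vec m} {w : (Fin d → ℕ) → Space d → Vec m} (h : IsJet Ω F N a f u w)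
    (τ : Space d) :
    IsJet Ω F N (τ + a) (expiMul τ f) (fun x => expi τ x • u x)
      (fun α x => expi τ x • ∑ β ∈ subIndices α, leibnizCoeff τ α β • w β x) where
  extends_f := by
    filter_upwards [coeFn_expiMul τ f, h.1] with x h1 h2
    rw [h1, h2]
  quasiperiodic ω hω := by
    filter_upwards [h.2 ω hω] with x hx
    rw [hx, expi_add_right, expi_add, smul_smul, smul_smul]
    ring_nf
  memLp α hα := by
    refine MemLp.expi_smul τ ?_
    refine memLp_finsetSum _ fun β hβ => ?_
    exact MemLp.const_smul (h.3 β ((sum_le_of_mem_subIndices hβ).trans hα)) (leibnizCoeff τ α β)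
  hasWeakD α hα := HasWeakD.expi_smul τ fun β hβ => h.4 β ((sum_le_of_mem_subIndices hβ).trans hα)

theorem toEuclideanLin_eq_sum (M : Matrix (Fin m) (Fin m) ℂ) (v : Vec m) :
    M.toEuclideanLin v = ∑ i, ∑ j, (M i j * v j) • EuclideanSpace.single i (1 : ℂ) := by
  ext k
  rw [Finset.sum_comm]
  simp [Matrix.toLpLin_apply, Matrix.mulVec, dotProduct, Pi.single_apply]

theorem norm_toEuclideanLin_le {M : Matrix (Fin m) (Fin m) ℂ} {C : ℝ} (hM : ∀ i j, ‖M i j‖ ≤ C)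
    (v : Vec m) : ‖M.toEuclideanLin v‖ ≤ (∑ _i : Fin m, ∑ _j : Fin m, C) * ‖v‖ := by
  rw [toEuclideanLin_eq_sum, Finset.sum_mul]
  refine norm_sum_le_of_le _ fun i _ => ?_
  rw [Finset.sum_mul]
  refine norm_sum_le_of_le _ fun j _ => ?_
  rw [norm_smul, norm_mul, PiLp.norm_single, norm_one, mul_one]
  exact mul_le_mul (hM i j) (PiLp.norm_apply_le v j) (norm_nonneg _)
    ((norm_nonneg _).trans (hM i j))

theorem aestronglyMeasurable_toEuclideanLin {μ : Measure (Space d)}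
    {M : Space d → Matrix (Fin m) (Fin m) ℂ} (hM : ∀ i j, Measurable fun x => M x i j)
    {v : Space d → Vec m} (hv : AEStronglyMeasurable v μ) :
    AEStronglyMeasurable (fun x => (M x).toEuclideanLin (v x)) μ := by
  simp only [toEuclideanLin_eq_sum]
  refine Finset.aestronglyMeasurable_fun_sum _ fun i _ =>
    Finset.aestronglyMeasurable_fun_sum _ fun j _ => ?_
  have : AEStronglyMeasurable (fun x => v x j) μ :=
    (EuclideanSpace.proj (𝕜 := ℂ) j).continuous.comp_aestronglyMeasurable hv
  exact ((hM i j).aestronglyMeasurable.mul this).smul_const _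

variable {Ω : Submodule ℤ (Space d)}

theorem multiIndices_subset (d N : ℕ) : multiIndices d N ⊆ multiIndicesLT d (N + 1) :=
  fun _ h => mem_multiIndicesLT.2 (Nat.lt_succ_of_le (mem_multiIndices.1 h).le)

theorem multiIndicesLT_subset (d N : ℕ) : multiIndicesLT d N ⊆ multiIndicesLT d (N + 1) :=
  fun _ h => mem_multiIndicesLT.2 ((mem_multiIndicesLT.1 h).trans (Nat.lt_succ_self N))

theorem DiffExpr.exists_norm_apply_le (Q : DiffExpr d m Ω) (s : ℕ) :
    ∃ C : ℝ, 0 ≤ C ∧ ∀ (z : (Fin d → ℕ) → Space d → Vec m) (x : Space d),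
      ‖Q.apply s z x‖ ≤ C * ∑ α ∈ multiIndicesLT d (2 * s + 1), ‖z α x‖ := by
  have h1 : ∀ α, ∃ C : ℝ, 0 ≤ C ∧ ∀ v : Vec m,
      ‖((Q.top α).map Complex.ofReal).toEuclideanLin v‖ ≤ C * ‖v‖ := fun α =>
    ⟨‖LinearMap.toContinuousLinearMap ((Q.top α).map Complex.ofReal).toEuclideanLin‖,
      norm_nonneg _, fun v => ContinuousLinearMap.le_opNorm
        (LinearMap.toContinuousLinearMap ((Q.top α).map Complex.ofReal).toEuclideanLin) v⟩
  have h2 : ∀ α, ∃ C : ℝ, 0 ≤ C ∧ ∀ (x : Space d) (v : Vec m),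
      ‖(Q.low α x).toEuclideanLin v‖ ≤ C * ‖v‖ := fun α => by
    obtain ⟨C, hC⟩ := Q.low_bounded α
    refine ⟨∑ _i : Fin m, ∑ _j : Fin m, |C|, by positivity, fun x v => ?_⟩
    exact norm_toEuclideanLin_le (fun i j => (hC x i j).trans (le_abs_self C)) v
  choose C₁ hC₁ hb₁ using h1
  choose C₂ hC₂ hb₂ using h2
  set S := multiIndicesLT d (2 * s + 1) with hS
  refine ⟨∑ α ∈ S, C₁ α + ∑ α ∈ S, C₂ α,
    add_nonneg (Finset.sum_nonneg fun α _ => hC₁ α) (Finset.sum_nonneg fun α _ => hC₂ α),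
    fun z x => ?_⟩
  have key : ∀ (S' : Finset (Fin d → ℕ)) (C : (Fin d → ℕ) → ℝ)
      (g : (Fin d → ℕ) → Vec m), S' ⊆ S → (∀ α, 0 ≤ C α) → (∀ α, ‖g α‖ ≤ C α * ‖z α x‖) →
      ‖∑ α ∈ S', g α‖ ≤ (∑ α ∈ S, C α) * ∑ α ∈ S, ‖z α x‖ := by
    intro S' C g hS' hC hg
    calc ‖∑ α ∈ S', g α‖ ≤ ∑ α ∈ S', (∑ α ∈ S, C α) * ‖z α x‖ :=
          norm_sum_le_of_le _ fun α hα => (hg α).trans (mul_le_mul_of_nonneg_right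
            (Finset.single_le_sum (f := C) (fun β _ => hC β) (hS' hα)) (norm_nonneg _))
      _ ≤ ∑ α ∈ S, (∑ α ∈ S, C α) * ‖z α x‖ :=
          Finset.sum_le_sum_of_subset_of_nonneg hS' fun α _ _ =>
            mul_nonneg (Finset.sum_nonneg fun β _ => hC β) (norm_nonneg _)
      _ = _ := (Finset.mul_sum _ _ _).symm
  rw [DiffExpr.apply, add_mul]
  exact (norm_add_le _ _).trans (add_le_add
    (key _ C₁ _ (multiIndices_subset d _) hC₁ fun α => hb₁ α _)
    (key _ C₂ _ (multiIndicesLT_subset d _) hC₂ fun α => hb₂ α x _))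

theorem DiffExpr.aestronglyMeasurable_apply (Q : DiffExpr d m Ω) (s : ℕ) {μ : Measure (Space d)}
    {z : (Fin d → ℕ) → Space d → Vec m}
    (hz : ∀ α, ∑ i, α i ≤ 2 * s → AEStronglyMeasurable (z α) μ) :
    AEStronglyMeasurable (Q.apply s z) μ := by
  unfold DiffExpr.apply
  refine (Finset.aestronglyMeasurable_fun_sum _ fun α hα => ?_).add
    (Finset.aestronglyMeasurable_fun_sum _ fun α hα => ?_)
  · exact aestronglyMeasurable_toEuclideanLin (M := fun _ => (Q.top α).map Complex.ofReal)
      (fun i j => measurable_const) (hz α (mem_multiIndices.1 hα).le)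
  · exact aestronglyMeasurable_toEuclideanLin (Q.low_measurable α)
      (hz α (mem_multiIndicesLT.1 hα).le)

theorem DiffExpr.apply_smul_add (Q : DiffExpr d m Ω) (s : ℕ) (c : Space d → ℂ)
    (w z : (Fin d → ℕ) → Space d → Vec m) (x : Space d) :
    Q.apply s (fun α x => c x • (w α x + z α x)) x = c x • (Q.apply s w x + Q.apply s z x) := by
  simp only [DiffExpr.apply, map_smul, map_add, smul_add, Finset.sum_add_distrib, Finset.smul_sum]
  abel

/-- The total size of the coefficients of the lower-order terms in `(D + t)_α - D_α`,
`|α| ≤ N`. -/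
def leibnizDefect (d N : ℕ) (t : Space d) : ℝ :=
  ∑ α ∈ multiIndicesLT d (N + 1), ∑ β ∈ (subIndices α).erase α, ‖leibnizCoeff t α β‖

theorem leibnizDefect_nonneg (N : ℕ) (t : Space d) : 0 ≤ leibnizDefect d N t :=
  Finset.sum_nonneg fun _ _ => Finset.sum_nonneg fun _ _ => norm_nonneg _

theorem continuous_leibnizDefect (N : ℕ) : Continuous (leibnizDefect d N) :=
  continuous_finsetSum _ fun α _ => continuous_finsetSum _ fun β _ =>
    (continuous_leibnizCoeff α β).norm

theorem leibnizDefect_zero (N : ℕ) : leibnizDefect d N 0 = 0 :=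
  Finset.sum_eq_zero fun α _ => Finset.sum_eq_zero fun β hβ => by
    rw [leibnizCoeff_zero (Finset.mem_erase.1 hβ).2 (Finset.mem_erase.1 hβ).1, norm_zero]

/-- Multiplication by `e^{i⟨τ, x⟩}` maps the graph of `T_a` to that of `T_{τ + a}` up to terms of
lower order. -/
theorem exists_mem_blochGraph_expiMul (Q : DiffExpr d m Ω) (s : ℕ) :
    ∃ C : ℝ, 0 ≤ C ∧ ∀ (B B' : L2 m F →L[ℂ] L2 m F) (a τ : Space d) (f g : L2 m F)
      (u : Space d → Vec m) (w : (Fin d → ℕ) → Space d → Vec m), IsJet Ω F (2 * s) a f u w →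
      (g =ᵐ[volume.restrict F] fun x => Q.apply s w x + B f x) →
      ∃ r : L2 m F,
        ‖r‖ ≤ C * leibnizDefect d (2 * s) τ *
          ∑ α ∈ multiIndicesLT d (2 * s), (eLpNorm (w α) 2 (volume.restrict F)).toReal ∧
        (expiMul τ f, expiMul τ (g - B f + r) + B' (expiMul τ f)) ∈
          blochGraph F s Q B' (τ + a) := by
  obtain ⟨C, hC, hQ⟩ := Q.exists_norm_apply_le s
  refine ⟨C, hC, fun B B' a τ f g u w h hg => ?_⟩
  set μ := (volume : Measure (Space d)).restrict F
  -- The part of `(D + τ)_α u` beyond `D_α u`. The remainder `r` is the differential expression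
  -- applied to these functions.
  set z : (Fin d → ℕ) → Space d → Vec m :=
    fun α x => ∑ β ∈ (subIndices α).erase α, leibnizCoeff τ α β • w β x with hz
  have hsplit : ∀ α x, ∑ β ∈ subIndices α, leibnizCoeff τ α β • w β x = w α x + z α x := by
    intro α x
    rw [hz, ← Finset.add_sum_erase _ _ (mem_subIndices.2 fun k => le_rfl : α ∈ subIndices α),
      leibnizCoeff_self, one_smul]
  have hjet := h.expi_smul τ
  simp only [hsplit] at hjet
  have hzm : ∀ α, ∑ i, α i ≤ 2 * s → AEStronglyMeasurable (z α) μ := fun α hα =>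
    Finset.aestronglyMeasurable_fun_sum _ fun β hβ => AEStronglyMeasurable.const_smul
      (h.3 β ((sum_le_of_mem_subIndices (Finset.mem_of_mem_erase hβ)).trans hα)).1
      (leibnizCoeff τ α β)
  have hpt : ∀ x, ‖Q.apply s z x‖ ≤ C * leibnizDefect d (2 * s) τ *
      ‖∑ α ∈ multiIndicesLT d (2 * s), ‖w α x‖‖ := by
    intro x
    rw [Real.norm_of_nonneg (Finset.sum_nonneg fun _ _ => norm_nonneg _), mul_assoc]
    refine (hQ z x).trans (mul_le_mul_of_nonneg_left ?_ hC)
    rw [leibnizDefect, Finset.sum_mul]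
    refine Finset.sum_le_sum fun α hα => ?_
    rw [Finset.sum_mul]
    refine norm_sum_le_of_le _ fun β hβ => ?_
    rw [norm_smul]
    refine mul_le_mul_of_nonneg_left ?_ (norm_nonneg _)
    refine Finset.single_le_sum (f := fun α => ‖w α x‖) (fun _ _ => norm_nonneg _) ?_
    -- Since `|α| ≤ 2s` and `β ≠ α`, only orders up to `2s - 1` occur, those controlled by the a
    -- priori estimate.
    have h1 := mem_multiIndicesLT.1 hα
    have h2 := sum_lt_of_mem_subIndices (Finset.mem_of_mem_erase hβ) (Finset.ne_of_mem_erase hβ)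
    exact mem_multiIndicesLT.2 (by omega)
  have hW : ∀ α ∈ multiIndicesLT d (2 * s), MemLp (fun x => ‖w α x‖) 2 μ := fun α hα =>
    (h.3 α (mem_multiIndicesLT.1 hα).le).norm
  have hWs : MemLp (fun x => ∑ α ∈ multiIndicesLT d (2 * s), ‖w α x‖) 2 μ :=
    memLp_finsetSum _ hW
  have hrem : MemLp (Q.apply s z) 2 μ :=
    hWs.of_le_mul (Q.aestronglyMeasurable_apply s hzm) (Eventually.of_forall hpt)
  refine ⟨hrem.toLp, ?_, ?_⟩
  · have hκ : 0 ≤ C * leibnizDefect d (2 * s) τ := mul_nonneg hC (leibnizDefect_nonneg _ _)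
    have h1 : eLpNorm (Q.apply s z) 2 μ ≤ ENNReal.ofReal (C * leibnizDefect d (2 * s) τ) *
        ∑ α ∈ multiIndicesLT d (2 * s), eLpNorm (w α) 2 μ := by
      refine (eLpNorm_le_mul_eLpNorm_of_ae_le_mul (Eventually.of_forall hpt) 2).trans ?_
      gcongr
      have h2 := eLpNorm_sum_le (μ := μ) (p := 2) (s := multiIndicesLT d (2 * s))
        (f := fun α x => ‖w α x‖) (fun α hα => (hW α hα).1) (by norm_num)
      simp only [eLpNorm_norm] at h2
      refine le_trans (le_of_eq ?_) h2
      congr 1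
      ext x
      simp
    have hfin : ∀ α ∈ multiIndicesLT d (2 * s), eLpNorm (w α) 2 μ ≠ ⊤ := fun α hα =>
      (h.3 α (mem_multiIndicesLT.1 hα).le).2.ne
    rw [Lp.norm_toLp]
    refine (ENNReal.toReal_mono (ENNReal.mul_ne_top ENNReal.ofReal_ne_top
      (ENNReal.sum_ne_top.2 hfin)) h1).trans (le_of_eq ?_)
    rw [ENNReal.toReal_mul, ENNReal.toReal_ofReal hκ, ENNReal.toReal_sum hfin]
  · refine ⟨_, _, hjet, ?_⟩
    simp only
    filter_upwards [hg, hrem.coeFn_toLp, coeFn_expiMul τ (g - B f + hrem.toLp),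
      Lp.coeFn_add (expiMul τ (g - B f + hrem.toLp)) (B' (expiMul τ f)),
      Lp.coeFn_add (g - B f) hrem.toLp, Lp.coeFn_sub g (B f)] with x h1 h2 h3 h4 h5 h6
    rw [h4, Pi.add_apply, h3, h5, Pi.add_apply, h6, Pi.sub_apply, h1, h2, add_sub_cancel_right,
      Q.apply_smul_add]

end Gauge

/-! ### Fixing the phase of an eigenvector. -/

section Phase

variable {H : Type*} [NormedAddCommGroup H] [InnerProductSpace ℂ H]

/-- The phase of the eigenvector of a simple eigenvalue can be fixed by a linear functional. -/
theorem IsSimpleEigenvalue.exists_phase {A : H →ₗ.[ℂ] H} {μ : ℝ} (hs : IsSimpleEigenvalue A μ)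
    (p : H) (hp : ∀ ψ, IsNormalizedEigenfunction A μ ψ → inner ℂ p ψ ≠ 0) :
    ∃ Ψ, ∀ ψ, (IsNormalizedEigenfunction A μ ψ ∧ (inner ℂ p ψ).arg = 0) ↔ ψ = Ψ := by
  obtain ⟨ψ₁, hψ₁, hψ₁n⟩ : ∃ ψ, IsNormalizedEigenfunction A μ ψ := by
    obtain ⟨x, hx, -⟩ := finrank_eq_one_iff'.1 hs
    have hx' : ‖(x : H)‖ ≠ 0 := by simpa using hx
    refine ⟨((‖(x : H)‖⁻¹ : ℝ) : ℂ) • (x : H), Submodule.smul_mem _ _ x.2, ?_⟩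
    rw [norm_smul, Complex.norm_real, norm_inv, norm_norm, inv_mul_cancel₀ hx']
  -- Without this, uniqueness would fail: `Complex.arg 0 = 0`, so every phase would satisfy the
  -- condition.
  have hne := hp ψ₁ ⟨hψ₁, hψ₁n⟩
  have hne' : ‖inner ℂ p ψ₁‖ ≠ 0 := norm_ne_zero_iff.2 hne
  set z := inner ℂ p ψ₁ with hz
  have hzz : (starRingEnd ℂ) z * z = (‖z‖ : ℂ) ^ 2 := by
    rw [← Complex.normSq_eq_conj_mul_self, Complex.normSq_eq_norm_sq]
    push_cast
    rfl
  have hzC : (‖z‖ : ℂ) ≠ 0 := Complex.ofReal_ne_zero.2 hne'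
  refine ⟨((starRingEnd ℂ) z / ‖z‖) • ψ₁, fun ψ => ⟨?_, ?_⟩⟩
  · rintro ⟨hψ, harg⟩
    have hmem := hψ.1
    rw [hs.eigenspace_eq_span ⟨hψ₁, hψ₁n⟩, Submodule.mem_span_singleton] at hmem
    obtain ⟨c, rfl⟩ := hmem
    have hc : ‖c‖ = 1 := by
      have := hψ.2
      rwa [norm_smul, hψ₁n, mul_one] at this
    rw [inner_smul_right, ← hz] at harg
    have h1 : c * z = (‖z‖ : ℂ) := by
      have h := Complex.norm_mul_exp_arg_mul_I (c * z)
      rw [harg, norm_mul, hc, one_mul] at h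
      simpa using h.symm
    congr 1
    have h2 : c * (z * (starRingEnd ℂ) z) = ‖z‖ * (starRingEnd ℂ) z := by
      rw [← mul_assoc, h1]
    rw [mul_comm z, hzz] at h2
    rw [eq_div_iff hzC]
    refine mul_right_cancel₀ hzC ?_
    rw [mul_assoc, ← sq, h2, mul_comm]
  · rintro rfl
    refine ⟨⟨Submodule.smul_mem _ _ hψ₁, ?_⟩, ?_⟩
    · rw [norm_smul, hψ₁n, norm_div, RCLike.norm_conj, Complex.norm_real, norm_norm,
        div_self hne', one_mul]
    · rw [inner_smul_right, ← hz, div_mul_eq_mul_div, hzz, sq, mul_div_assoc, div_self hzC,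
        mul_one]
      exact Complex.arg_ofReal_of_nonneg (norm_nonneg _)

/-- Two unit vectors with nearly the same direction and the same phase are close. -/
theorem norm_sub_le_of_arg_eq_zero {f ψ p : H} {ρ : ℝ} (hf : ‖f‖ = 1) (hψ : ‖ψ‖ = 1)
    (hne : inner ℂ p ψ ≠ 0) (hargψ : (inner ℂ p ψ).arg = 0) (hargf : (inner ℂ p f).arg = 0)
    (h : ‖f - inner ℂ ψ f • ψ‖ ≤ ρ) :
    ‖f - ψ‖ ≤ (2 + 2 * (‖p‖ / ‖inner ℂ p ψ‖)) * ρ := by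
  set c := inner ℂ ψ f
  set r := ‖inner ℂ p ψ‖ with hr
  have hrpos : 0 < r := norm_pos_iff.2 hne
  have e1 : inner ℂ p ψ = (r : ℂ) := by
    have h := Complex.norm_mul_exp_arg_mul_I (inner ℂ p ψ)
    rw [hargψ] at h
    simpa using h.symm
  set x := ‖inner ℂ p f‖ with hx
  have e2 : inner ℂ p f = (x : ℂ) := by
    have h := Complex.norm_mul_exp_arg_mul_I (inner ℂ p f)
    rw [hargf] at h
    simpa using h.symm
  have h1 : ‖(x : ℂ) - c * r‖ ≤ ‖p‖ * ρ := by
    have h2 : (x : ℂ) - c * r = inner ℂ p (f - c • ψ) := by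
      rw [inner_sub_right, inner_smul_right, e1, e2]
    rw [h2]
    exact (norm_inner_le_norm _ _).trans (mul_le_mul_of_nonneg_left h (norm_nonneg _))
  have h2 : ‖((x / r : ℝ) : ℂ) - c‖ ≤ ‖p‖ / r * ρ := by
    have h3 : ((x / r : ℝ) : ℂ) - c = ((x : ℂ) - c * r) / r := by
      have : (r : ℂ) ≠ 0 := Complex.ofReal_ne_zero.2 hrpos.ne'
      push_cast
      field_simp
    rw [h3, norm_div, Complex.norm_real, Real.norm_of_nonneg hrpos.le, div_mul_eq_mul_div]
    gcongr
  have h3 : |x / r - ‖c‖| ≤ ‖p‖ / r * ρ := by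
    have h4 := abs_norm_sub_norm_le ((x / r : ℝ) : ℂ) c
    rw [Complex.norm_real, Real.norm_of_nonneg (by positivity)] at h4
    exact h4.trans h2
  have h4 : |‖c‖ - 1| ≤ ρ := by
    have h5 := abs_norm_sub_norm_le f (c • ψ)
    rw [norm_smul, hψ, hf, mul_one, abs_sub_comm] at h5
    exact h5.trans h
  -- Pairing with `p` shows that `c` is close to the nonnegative number `x / r`, and the norms show
  -- that `|c|` is close to `1`; so `c` is close to `1`.
  have h5 : ‖c - 1‖ ≤ ‖p‖ / r * ρ + ‖p‖ / r * ρ + ρ := by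
    have h6 : c - 1 = -(((x / r : ℝ) : ℂ) - c) + ((x / r - ‖c‖ : ℝ) : ℂ) +
        ((‖c‖ - 1 : ℝ) : ℂ) := by
      push_cast
      ring
    rw [h6]
    refine (norm_add₃_le).trans ?_
    rw [norm_neg, Complex.norm_real, Complex.norm_real, Real.norm_eq_abs, Real.norm_eq_abs]
    linarith
  have h6 : f - ψ = (f - c • ψ) + (c - 1) • ψ := by
    rw [sub_smul, one_smul]
    abel
  rw [h6]
  refine (norm_add_le _ _).trans ?_
  rw [norm_smul, hψ, mul_one]
  linarith

end Phase

/-! ### Relative closeness of the operators `T_t`. -/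

section Bloch

variable {d m : ℕ} {F : Set (Space d)} {Ω : Submodule ℤ (Space d)}

/-- The level set is the preimage of a countable set of reals under a coordinate map. -/
theorem volume_setOf_expi_single_eq (k : Fin d) (c : ℂ) :
    (volume : Measure (Space d)) {x | expi (EuclideanSpace.single k 1) x = c} = 0 := by
  have hcount : {y : ℝ | Complex.exp (Complex.I * (y : ℂ)) = c}.Countable := by
    by_cases h : ∃ y₀ : ℝ, Complex.exp (Complex.I * (y₀ : ℂ)) = c
    · obtain ⟨y₀, rfl⟩ := h
      refine (Set.countable_range fun n : ℤ => y₀ + n * (2 * Real.pi)).mono fun y hy => ?_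
      have hy : Complex.exp (Complex.I * (y : ℂ)) = Complex.exp (Complex.I * (y₀ : ℂ)) := hy
      obtain ⟨n, hn⟩ := Complex.exp_eq_exp_iff_exists_int.1 hy
      refine ⟨n, ?_⟩
      have h1 : Complex.I * (y : ℂ) = Complex.I * (y₀ + n * (2 * Real.pi) : ℂ) := by
        rw [hn]
        ring
      have h2 := mul_left_cancel₀ Complex.I_ne_zero h1
      exact_mod_cast h2.symm
    · have : {y : ℝ | Complex.exp (Complex.I * (y : ℂ)) = c} = ∅ :=
        Set.eq_empty_iff_forall_notMem.2 fun y hy => h ⟨y, hy⟩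
      rw [this]
      exact Set.countable_empty
  have hq : Measure.QuasiMeasurePreserving (fun x : Space d => x k) volume volume :=
    (Measure.quasiMeasurePreserving_eval (fun _ : Fin d => (volume : Measure ℝ)) k).comp
      (PiLp.volume_preserving_ofLp (Fin d)).quasiMeasurePreserving
  have h := hq.preimage_null (hcount.measure_zero volume)
  refine Eq.trans (congrArg _ ?_) h
  ext x
  simp [expi, EuclideanSpace.inner_single_left]

/-- On a nonzero finite-dimensional complex space, multiplication by `e^{i x_1}` would have an
eigenvector; it has none, as its symbol takes each value only on a null set. -/
theorem not_finiteDimensional_L2 (hd : 1 ≤ d) [Nontrivial (L2 m F)] :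
    ¬ FiniteDimensional ℂ (L2 m F) := by
  intro hfd
  set τ : Space d := EuclideanSpace.single ⟨0, hd⟩ 1
  obtain ⟨c, hc⟩ := Module.End.exists_eigenvalue
    ((expiMul (m := m) (F := F) τ).toLinearEquiv : L2 m F →ₗ[ℂ] L2 m F)
  obtain ⟨f, hf⟩ := hc.exists_hasEigenvector
  have hfe : expiMul τ f = c • f := hf.apply_eq_smul
  refine hf.2 (Lp.ext ?_)
  have hnull : ∀ᵐ x ∂(volume : Measure (Space d)).restrict F, expi τ x ≠ c := by
    refine ae_restrict_of_ae ?_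
    rw [ae_iff]
    simpa using volume_setOf_expi_single_eq ⟨0, hd⟩ c
  have h := coeFn_expiMul τ f
  rw [hfe] at h
  filter_upwards [h, Lp.coeFn_smul c f, hnull,
    Lp.coeFn_zero (Vec m) 2 ((volume : Measure (Space d)).restrict F)] with x h1 h2 h3 h4
  rw [h4]
  have h5 : (expi τ x - c) • f x = 0 := by
    rw [sub_smul, ← h1, h2, Pi.smul_apply, sub_self]
  exact (smul_eq_zero.1 h5).resolve_left (sub_ne_zero.2 h3)

theorem exists_mem_domain_of_mem_blochGraph [DiscreteTopology Ω]
    (hF : IsAddFundamentalDomain Ω F volume) {s : ℕ} {Q : DiffExpr d m Ω}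
    {B : L2 m F →L[ℂ] L2 m F} {t : Space d} {f g : L2 m F} (h : (f, g) ∈ blochGraph F s Q B t) :
    ∃ hf : f ∈ (blochOp F s Q B t).domain, blochOp F s Q B t ⟨f, hf⟩ = g := by
  rw [← blochOp_graph hF] at h
  obtain ⟨y, hy, e⟩ := (LinearPMap.mem_graph_iff _).1 h
  simp only at hy e
  subst hy
  exact ⟨y.2, e⟩

theorem exists_isJet_of_mem_domain [DiscreteTopology Ω]
    (hF : IsAddFundamentalDomain Ω F volume) {s : ℕ} {Q : DiffExpr d m Ω}
    {B : L2 m F →L[ℂ] L2 m F} {t : Space d} (f : (blochOp F s Q B t).domain) :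
    ∃ u w, IsJet Ω F (2 * s) t (f : L2 m F) u w ∧
      ((blochOp F s Q B t f : L2 m F) : Space d → Vec m) =ᵐ[volume.restrict F]
        fun x => Q.apply s w x + B f x := by
  have h := LinearPMap.mem_graph (blochOp F s Q B t) f
  rw [blochOp_graph hF] at h
  exact h

/-- The inverse gauge transformation is again one, with parameter `-(t - a)`. So the domains
correspond exactly, which `RelClose.symm` requires. -/
theorem expiMul_symm_mem_domain [DiscreteTopology Ω]
    (hF : IsAddFundamentalDomain Ω F volume) (s : ℕ) (Q : DiffExpr d m Ω)
    (B B' : L2 m F →L[ℂ] L2 m F) (a t : Space d) {g : L2 m F}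
    (hg : g ∈ (blochOp F s Q B' t).domain) :
    (expiMul (t - a)).symm g ∈ (blochOp F s Q B a).domain := by
  obtain ⟨C, -, hC⟩ := exists_mem_blochGraph_expiMul (F := F) Q s
  obtain ⟨u, w, hjet, e⟩ := exists_isJet_of_mem_domain hF ⟨g, hg⟩
  obtain ⟨r, -, hr⟩ := hC B' B t (-(t - a)) g _ u w hjet e
  have ht : -(t - a) + t = a := by abel
  rw [ht] at hr
  obtain ⟨h, -⟩ := exists_mem_domain_of_mem_blochGraph hF hr
  exact h

theorem exists_relClose_blochOp [DiscreteTopology Ω]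
    (hF : IsAddFundamentalDomain Ω F volume) {R : ℝ} (hR : ∀ x ∈ F, ‖x‖ ≤ R) (s : ℕ)
    (Q : DiffExpr d m Ω) (B : L2 m F →L[ℂ] L2 m F) (a : Space d) {δ c : ℝ} (hδ : 0 < δ)
    (hc : 0 < c)
    (hest : ∀ (f : (blochOp F s Q B a).domain) (u : Space d → Vec m)
        (w : (Fin d → ℕ) → Space d → Vec m), IsJet Ω F (2 * s) a (f : L2 m F) u w →
        δ * ∑ α ∈ multiIndicesLT d (2 * s), (eLpNorm (w α) 2 (volume.restrict F)).toReal ≤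
          ‖blochOp F s Q B a f + (c : ℂ) • (f : L2 m F) - B f‖ + ‖(f : L2 m F)‖) :
    ∃ K : ℝ, 0 ≤ K ∧ ∀ (B' : L2 m F →L[ℂ] L2 m F) (t : Space d),
      RelClose (K * leibnizDefect d (2 * s) (t - a) + ‖B' - B‖ + 2 * ‖B‖ * (‖t - a‖ * |R|))
        (blochOp F s Q B a) (blochOp F s Q B' t) (expiMul (t - a)) := by
  obtain ⟨C, hC, hgraph⟩ := exists_mem_blochGraph_expiMul (F := F) Q s
  -- Passing from the differential part in the estimate to `T_a` costs `c ‖f‖ + ‖B‖ ‖f‖`, and the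
  -- estimate itself one more `‖f‖`; `C` bounds the coefficients of the expression.
  refine ⟨C * ((1 + c + ‖B‖ + 1) / δ), by positivity, fun B' t f => ?_⟩
  obtain ⟨u, w, hjet, e⟩ := exists_isJet_of_mem_domain hF f
  obtain ⟨r, hr, hmem⟩ := hgraph B B' a (t - a) f _ u w hjet e
  rw [sub_add_cancel] at hmem
  obtain ⟨hdom, heq⟩ := exists_mem_domain_of_mem_blochGraph hF hmem
  refine ⟨hdom, ?_⟩
  rw [heq]
  set g := blochOp F s Q B a f
  set M := expiMul (m := m) (F := F) (t - a)
  set κ := leibnizDefect d (2 * s) (t - a)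
  have hκ : 0 ≤ κ := leibnizDefect_nonneg _ _
  set S := ∑ α ∈ multiIndicesLT d (2 * s), (eLpNorm (w α) 2 (volume.restrict F)).toReal
  have hBf : ‖B f‖ ≤ ‖B‖ * ‖(f : L2 m F)‖ := B.le_opNorm _
  have hS : S ≤ (1 + c + ‖B‖ + 1) / δ * (‖g‖ + ‖(f : L2 m F)‖) := by
    rw [div_mul_eq_mul_div, le_div_iff₀ hδ, mul_comm]
    refine (hest f u w hjet).trans ?_
    have h1 : ‖g + (c : ℂ) • (f : L2 m F) - B f‖ ≤
        ‖g‖ + c * ‖(f : L2 m F)‖ + ‖B‖ * ‖(f : L2 m F)‖ := by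
      refine (norm_sub_le _ _).trans (add_le_add ((norm_add_le _ _).trans ?_) hBf)
      rw [norm_smul, Complex.norm_real, Real.norm_of_nonneg hc.le]
    have h2 : 0 ≤ (c + ‖B‖) * ‖g‖ := by positivity
    have h3 := norm_nonneg (f : L2 m F)
    have h4 := norm_nonneg g
    linarith
  have hr' : ‖r‖ ≤ C * ((1 + c + ‖B‖ + 1) / δ) * κ * (‖g‖ + ‖(f : L2 m F)‖) := by
    refine hr.trans ((mul_le_mul_of_nonneg_left hS (by positivity)).trans (le_of_eq ?_))
    ring
  have hM : ∀ h : L2 m F, ‖M h - h‖ ≤ ‖t - a‖ * |R| * ‖h‖ :=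
    norm_expiMul_sub_le hF.nullMeasurableSet (fun x hx => (hR x hx).trans (le_abs_self R)) _
  -- The bounded terms enter through `B' M - M B = (B' - B) M + B (M - 1) - (M - 1) B`.
  have hsplit : M (g - B f + r) + B' (M f) - M g =
      M r + ((B' - B) (M f) + B (M f - f) - (M (B f) - B f)) := by
    simp only [map_add, map_sub, sub_apply]
    abel
  rw [hsplit]
  have h1 : ‖(B' - B) (M f)‖ ≤ ‖B' - B‖ * ‖(f : L2 m F)‖ := by
    have := (B' - B).le_opNorm (M f)
    rwa [M.norm_map] at this
  have h2 : ‖B (M f - f)‖ ≤ ‖B‖ * (‖t - a‖ * |R| * ‖(f : L2 m F)‖) :=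
    (B.le_opNorm _).trans (mul_le_mul_of_nonneg_left (hM f) (norm_nonneg _))
  have h3 : ‖M (B f) - B f‖ ≤ ‖t - a‖ * |R| * (‖B‖ * ‖(f : L2 m F)‖) :=
    (hM _).trans (mul_le_mul_of_nonneg_left hBf (by positivity))
  have h4 : ‖M r + ((B' - B) (M f) + B (M f - f) - (M (B f) - B f))‖ ≤
      ‖r‖ + (‖(B' - B) (M f)‖ + ‖B (M f - f)‖ + ‖M (B f) - B f‖) := by
    refine (norm_add_le _ _).trans ?_
    rw [M.norm_map]
    gcongr
    refine (norm_sub_le _ _).trans ?_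
    gcongr
    exact norm_add_le _ _
  have h5 : 0 ≤ (‖B' - B‖ + 2 * ‖B‖ * (‖t - a‖ * |R|)) * ‖g‖ := by positivity
  linarith

theorem eventually_relClose_blochOp [DiscreteTopology Ω]
    (hF : IsAddFundamentalDomain Ω F volume) (hFb : Bornology.IsBounded F) (s : ℕ)
    (Q : DiffExpr d m Ω) {Fs : Set (Space d)} {B : Space d → (L2 m F →L[ℂ] L2 m F)}
    (hB : ContinuousOn B Fs) {a : Space d} (ha : a ∈ Fs) {δ c : ℝ} (hδ : 0 < δ) (hc : 0 < c)
    (hest : ∀ (f : (blochOp F s Q (B a) a).domain) (u : Space d → Vec m)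
        (w : (Fin d → ℕ) → Space d → Vec m), IsJet Ω F (2 * s) a (f : L2 m F) u w →
        δ * ∑ α ∈ multiIndicesLT d (2 * s), (eLpNorm (w α) 2 (volume.restrict F)).toReal ≤
          ‖blochOp F s Q (B a) a f + (c : ℂ) • (f : L2 m F) - B a f‖ + ‖(f : L2 m F)‖)
    {η : ℝ} (hη : 0 < η) :
    ∀ᶠ t in 𝓝[Fs] a,
      RelClose η (blochOp F s Q (B a) a) (blochOp F s Q (B t) t) (expiMul (t - a)) ∧
      RelClose η (blochOp F s Q (B t) t) (blochOp F s Q (B a) a) (expiMul (t - a)).symm := by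
  obtain ⟨R, hR⟩ := hFb.exists_norm_le
  obtain ⟨K, -, hK⟩ := exists_relClose_blochOp hF hR s Q (B a) a hδ hc hest
  have hsub : Tendsto (fun t : Space d => t - a) (𝓝[Fs] a) (𝓝 0) := by
    have : Tendsto (fun t : Space d => t - a) (𝓝 a) (𝓝 (a - a)) :=
      (continuous_id.sub continuous_const).tendsto a
    rw [sub_self] at this
    exact this.mono_left nhdsWithin_le_nhds
  have h1 : Tendsto (fun t => leibnizDefect d (2 * s) (t - a)) (𝓝[Fs] a) (𝓝 0) := by
    have := ((continuous_leibnizDefect (d := d) (2 * s)).tendsto 0).comp hsub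
    rwa [leibnizDefect_zero] at this
  have h2 : Tendsto (fun t => ‖B t - B a‖) (𝓝[Fs] a) (𝓝 0) :=
    tendsto_iff_norm_sub_tendsto_zero.1 (hB a ha)
  have h3 : Tendsto (fun t : Space d => ‖t - a‖) (𝓝[Fs] a) (𝓝 0) := by
    simpa using hsub.norm
  have hlim := ((h1.const_mul K).add h2).add ((h3.mul_const |R|).const_mul (2 * ‖B a‖))
  simp only [mul_zero, zero_mul, add_zero] at hlim
  -- Reversing the closeness needs a constant at most `1 / 2` and doubles it.
  have hη' : 0 < min (1 / 2) (η / 2) := by positivity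
  filter_upwards [hlim.eventually (ge_mem_nhds hη')] with t ht
  have hclose := (hK (B t) t).mono ht
  refine ⟨hclose.mono ((min_le_right _ _).trans (by linarith)), ?_⟩
  refine (hclose.symm hη'.le (min_le_left _ _) fun g hg =>
    expiMul_symm_mem_domain hF s Q (B a) (B t) a t hg).mono ?_
  have := min_le_right (1 / 2) (η / 2)
  linarith

theorem tendsto_expiMul_sub (hF : NullMeasurableSet F volume) (hFb : Bornology.IsBounded F)
    (a : Space d) (f : L2 m F) : Tendsto (fun t => expiMul (t - a) f) (𝓝 a) (𝓝 f) := by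
  obtain ⟨R, hR⟩ := hFb.exists_norm_le
  rw [tendsto_iff_norm_sub_tendsto_zero]
  have hlim : Tendsto (fun t : Space d => ‖t - a‖ * R * ‖f‖) (𝓝 a) (𝓝 0) := by
    have : Continuous fun t : Space d => ‖t - a‖ * R * ‖f‖ := by fun_prop
    simpa using this.tendsto a
  exact squeeze_zero (fun _ => norm_nonneg _) (fun t => norm_expiMul_sub_le hF hR (t - a) f) hlim

end Bloch

end Bloch

end

/-! ### The continuous choice of eigenfunctions. -/

theorem proposition2 {d m s : ℕ} (hd : 1 ≤ d) (hm : 1 ≤ m) (hs : 1 ≤ s)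
    -- the lattice `Ω` and a fundamental domain `F` of it
    (Ω : Submodule ℤ (Bloch.Space d)) [DiscreteTopology Ω] [IsZLattice ℝ Ω]
    (F : Set (Bloch.Space d)) (hF : IsAddFundamentalDomain Ω F volume)
    (hFb : Bornology.IsBounded F)
    -- a fundamental domain `Fs` of the dual lattice
    (Fs : Set (Bloch.Space d)) (hFs : Bloch.IsFundamentalSet (Bloch.dualLattice Ω) Fs)
    -- the differential expression, and its bounded term acting on `t`-quasiperiodic functions
    (Q : Bloch.DiffExpr d m Ω)
    (B : Bloch.Space d → (Bloch.L2 m F →L[ℂ] Bloch.L2 m F)) (hB : ContinuousOn B Fs)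
    -- the operators are self-adjoint, bounded below, with compact resolvent
    (hT : ∀ t ∈ Fs, Bloch.IsSBC (Bloch.blochOp F s Q (B t) t))
    -- the derivatives up to order `2s - 1` are estimated by the differential part
    (hest : ∃ δ > (0 : ℝ), ∃ c > (0 : ℝ), ∀ t ∈ Fs,
      ∀ (f : (Bloch.blochOp F s Q (B t) t).domain) (u : Bloch.Space d → Bloch.Vec m)
        (w : (Fin d → ℕ) → Bloch.Space d → Bloch.Vec m),
        Bloch.IsJet Ω F (2 * s) t (f : Bloch.L2 m F) u w →
        δ * ∑ α ∈ Bloch.multiIndicesLT d (2 * s), (eLpNorm (w α) 2 (volume.restrict F)).toReal ≤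
          ‖Bloch.blochOp F s Q (B t) t f + (c : ℂ) • (f : Bloch.L2 m F) - B t f‖
            + ‖(f : Bloch.L2 m F)‖)
    -- a simple Bloch eigenvalue at `a`
    (n : ℕ) (hn : 1 ≤ n) (a : Bloch.Space d) (ha : a ∈ Fs)
    (hsimple : Bloch.IsSimpleEigenvalue (Bloch.blochOp F s Q (B a) a)
      (Bloch.eigenvalue (Bloch.blochOp F s Q (B a) a) n))
    -- the lower bound for the plane wave coefficient near `a`
    (v : Bloch.Vec m) (ε : ℝ) (hε : 0 < ε)
    (hlower : ∀ᶠ t in 𝓝[Fs] a, ∀ ψ : Bloch.L2 m F,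
      Bloch.IsNormalizedEigenfunction (Bloch.blochOp F s Q (B t) t)
        (Bloch.eigenvalue (Bloch.blochOp F s Q (B t) t) n) ψ →
      ε < ‖Bloch.planeWaveCoeff v t ψ‖) :
    ∃ U ∈ 𝓝[Fs] a, U ⊆ Fs ∧
      (∀ t ∈ U, Bloch.IsSimpleEigenvalue (Bloch.blochOp F s Q (B t) t)
        (Bloch.eigenvalue (Bloch.blochOp F s Q (B t) t) n)) ∧
      ∃ Ψ : Bloch.Space d → Bloch.L2 m F,
        (∀ t ∈ U, ∀ ψ : Bloch.L2 m F,
          (Bloch.IsNormalizedEigenfunction (Bloch.blochOp F s Q (B t) t)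
              (Bloch.eigenvalue (Bloch.blochOp F s Q (B t) t) n) ψ ∧
            (Bloch.planeWaveCoeff v t ψ).arg = 0) ↔ ψ = Ψ t) ∧
        ContinuousOn Ψ U := by
  obtain ⟨δ, hδ, c, hc, hest⟩ := hest
  have hclose : ∀ b ∈ Fs, ∀ η > 0, ∀ᶠ t in 𝓝[Fs] b,
      Bloch.RelClose η (Bloch.blochOp F s Q (B b) b) (Bloch.blochOp F s Q (B t) t)
        (Bloch.expiMul (t - b)) ∧
      Bloch.RelClose η (Bloch.blochOp F s Q (B t) t) (Bloch.blochOp F s Q (B b) b)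
        (Bloch.expiMul (t - b)).symm := fun b hb η hη =>
    Bloch.eventually_relClose_blochOp hF hFb s Q hB hb hδ hc (hest b hb) hη
  -- The eigenfunction at `a` is itself the witness of a nonzero element.
  have hnontriv : Nontrivial (Bloch.L2 m F) := by
    obtain ⟨x, hx, -⟩ := finrank_eq_one_iff'.1 hsimple
    exact ⟨⟨x, 0, fun h => hx (Subtype.ext h)⟩⟩
  have hinf := Bloch.not_finiteDimensional_L2 (m := m) (F := F) hd
  -- Every point of this set satisfies all that was assumed at `a`, so the perturbation argument can
  -- be repeated at each `b ∈ U`.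
  set U := {t | t ∈ Fs ∧ Bloch.IsSimpleEigenvalue (Bloch.blochOp F s Q (B t) t)
      (Bloch.eigenvalue (Bloch.blochOp F s Q (B t) t) n) ∧
    ∀ ψ : Bloch.L2 m F, Bloch.IsNormalizedEigenfunction (Bloch.blochOp F s Q (B t) t)
      (Bloch.eigenvalue (Bloch.blochOp F s Q (B t) t) n) ψ →
      ε < ‖Bloch.planeWaveCoeff v t ψ‖} with hU
  have hphase : ∀ t, ∃ Ψ : Bloch.L2 m F, t ∈ U → ∀ ψ : Bloch.L2 m F,
      (Bloch.IsNormalizedEigenfunction (Bloch.blochOp F s Q (B t) t)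
          (Bloch.eigenvalue (Bloch.blochOp F s Q (B t) t) n) ψ ∧
        (Bloch.planeWaveCoeff v t ψ).arg = 0) ↔ ψ = Ψ := by
    intro t
    by_cases ht : t ∈ U
    · obtain ⟨p, hp⟩ := Bloch.exists_planeWave hFb v t
      obtain ⟨Ψ, hΨ⟩ := ht.2.1.exists_phase p fun ψ hψ => by
        rw [← hp, ← norm_pos_iff]
        exact hε.trans (ht.2.2 ψ hψ)
      refine ⟨Ψ, fun _ ψ => ?_⟩
      rw [hp]
      exact hΨ ψ
    · exact ⟨0, fun h => absurd h ht⟩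
  choose Ψ hΨ using hphase
  have hUFs : U ⊆ Fs := fun t ht => ht.1
  refine ⟨U, ?_, hUFs, fun t ht => ht.2.1, Ψ, hΨ, fun b hb => ?_⟩
  · obtain ⟨η, hη, hsim⟩ := Bloch.exists_eigenvalue_close (hT a ha) hinf hn hsimple one_pos
    filter_upwards [hclose a ha η hη, hlower, self_mem_nhdsWithin] with t h1 h2 ht
    exact ⟨ht, (hsim _ _ (hT t ht) h1.1 h1.2).1, h2⟩
  · obtain ⟨hbn, hbarg⟩ := (hΨ b hb (Ψ b)).2 rfl
    obtain ⟨p, hp⟩ := Bloch.exists_planeWave hFb v b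
    have hne : inner ℂ p (Ψ b) ≠ 0 := by
      rw [← hp, ← norm_pos_iff]
      exact hε.trans (hb.2.2 _ hbn)
    rw [hp] at hbarg
    set C := 2 + 2 * (‖p‖ / ‖inner ℂ p (Ψ b)‖)
    have hC : 0 < C := by positivity
    refine Metric.continuousWithinAt_iff'.2 fun r hr => ?_
    -- This `ρ` makes `‖M⁻¹ Ψ_t - Ψ_b‖ ≤ C ρ = r / 2`; the other half of `r` is for `‖M Ψ_b - Ψ_b‖`.
    obtain ⟨η, hη, hvec⟩ := Bloch.exists_eigenfunction_close (hT b hb.1) hinf hn hb.2.1 hbn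
      (ρ := r / (2 * C)) (by positivity)
    have hM := (Bloch.tendsto_expiMul_sub hF.nullMeasurableSet hFb b (Ψ b)).mono_left
      (nhdsWithin_le_nhds (s := U))
    filter_upwards [nhdsWithin_mono b hUFs (hclose b hb.1 η hη), self_mem_nhdsWithin,
      Metric.tendsto_nhds.1 hM (r / 2) (by positivity)] with t h1 ht h2
    obtain ⟨htn, htarg⟩ := (hΨ t ht (Ψ t)).2 rfl
    have h3 := (hvec _ _ (hT t ht.1) h1.1 h1.2).2 (Ψ t) htn
    set f := (Bloch.expiMul (t - b)).symm (Ψ t)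
    have hf : Bloch.expiMul (t - b) f = Ψ t := LinearIsometryEquiv.apply_symm_apply _ _
    have hfn : ‖f‖ = 1 := by rw [LinearIsometryEquiv.norm_map, htn.2]
    -- Now `f = M⁻¹ Ψ_t` and `Ψ_b` have zero phase with respect to the same vector `p`.
    rw [← hf, Bloch.planeWaveCoeff_expiMul, hp] at htarg
    have h4 := Bloch.norm_sub_le_of_arg_eq_zero hfn hbn.2 hne hbarg htarg h3
    have h5 : C * (r / (2 * C)) = r / 2 := by field_simp
    rw [h5] at h4
    rw [← hf]
    have h6 : dist (Bloch.expiMul (t - b) f) (Bloch.expiMul (t - b) (Ψ b)) ≤ r / 2 := by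
      rw [LinearIsometryEquiv.dist_map, dist_eq_norm]
      exact h4
    exact (dist_triangle _ _ _).trans_lt (by linarith)
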